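/- **Definitions.** A function $f\colon\mathbb{R}^d\to\mathbb{R}^{d'}$ is CPWL if it is continuous and $\mathbb{R}^d$ is a finite union of closed sets with nonempty, pairwise disjoint interiors on each of which $f$ agrees with an affine function. Its projection regions are the nonempty sets $\overline{\operatorname{int}\{x : f(x)=g(x)\}}$, with $g$ affine (one region for each distinct affine piece $g$ of $f$). A 1D CPWL path is a continuous map $\gamma\colon[a,b]\to\mathbb{R}^d$, $a<b$, that is affine on each of finitely many consecutive segments; its length is $\operatorname{len}(\gamma)=\int_a^b\|\gamma'(t)\|_2\,dt$. If $\Omega_1,\dots,\Omega_K$ are the projection regions of $f$, the number $\mathrm{kt}_f^\gamma$ of knots of $f$ along $\gamma$ is the number of points of discontinuity on $[a,b]$ of $t\mapsto(\mathbb{1}_{\Omega_1}(\gamma(t)),\dots,\mathbb{1}_{\Omega_K}(\gamma(t)))$, and the knot density is $\lambda_f^\gamma=\mathrm{kt}_f^\gamma/\operatorname{len}(\gamma)$ (equal to $0$ if $\operatorname{len}(\gamma)=0$, in which case there is no knot). $D_u\{f\}(x)$ denotes the derivative of $f$ at $x$ in direction $u$. **Corollary 3.** Let $f_{\theta_1},\dots,f_{\theta_L}$,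 with $f_{\theta_\ell}\colon\mathbb{R}^{d_\ell}\to\mathbb{R}^{d_{\ell+1}}$, be CPWL functions parameterized by independent and identically distributed random variables $\theta_1,\dots,\theta_L$ (each $f_{\theta_\ell}(x)$ depending measurably on the parameter), where $d_2=\cdots=d_L=W>d_{L+1}$. Suppose that there exist real numbers $\lambda_0\ge 0$ and $D_0\ge 0$ such that (i) for every $1\le\ell\le L$, every component $f_{\theta_\ell,k}$ of $f_{\theta_\ell}$ and every 1D CPWL path $\gamma$ in $\mathbb{R}^{d_\ell}$, $\mathbb{E}\big[\lambda_{f_{\theta_\ell,k}}^{\gamma}\big]\le\lambda_0$; (ii) for every $1\le\ell\le L$ and all $x,u\in\mathbb{R}^{d_1}$ with $\|u\|_2=1$, $\mathbb{E}\big[\|D_u\{f_{\theta_\ell}\circ\cdots\circ f_{\theta_1}\}(x)\|_2\big]\le D_0$, where the norm is counted as $0$ when the directional derivative does not exist. Then, for every 1D CPWL path $\gamma$ in $\mathbb{R}^{d_1}$, the knot density of $f_{\theta_L}\circ\cdots\circ f_{\theta_1}$ along $\gamma$ is a random variable (measurable up to a null set), and $$\mathbb{E}\big[\lambda_{f_{\theta_L}\circ\cdots\circ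 f_{\theta_1}}^{\gamma}\big]\le\max(D_0,1)\,\lambda_0\,W\,L .$$ -/

import Mathlib

open MeasureTheory ProbabilityTheory
open scoped ENNReal

noncomputable section

/-- A function on `ℝ^d` is continuous and piecewise linear (CPWL): it is continuous, and `ℝ^d` is a
finite union of closed sets, with nonempty and pairwise disjoint interiors, on each of which the
function agrees with an affine function. -/
def IsCPWL {d : ℕ} {V : Type*} [NormedAddCommGroup V] [NormedSpace ℝ V]
    (f : EuclideanSpace ℝ (Fin d) → V) : Prop :=
  Continuous f ∧
    ∃ (K : ℕ) (g : Fin K → (EuclideanSpace ℝ (Fin d) →ᵃ[ℝ] V))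
      (R : Fin K → Set (EuclideanSpace ℝ (Fin d))),
      (∀ k, IsClosed (R k)) ∧
      (∀ k, (interior (R k)).Nonempty) ∧
      (∀ j k, j ≠ k → Disjoint (interior (R j)) (interior (R k))) ∧
      (⋃ k, R k) = Set.univ ∧
      ∀ k, ∀ x ∈ R k, f x = g k x

/-- The projection regions of a CPWL function `f`, one for each of its distinct affine pieces `g`:
the closure of the open set on which `f` locally coincides with `g`, when this set is nonempty.
(Taking the closure of the interior discards the lower-dimensional set of points at which the value
of `f` merely happens to be equal to that of `g`.) -/
def projectionRegions {d : ℕ} {V : Type*} [NormedAddCommGroup V] [NormedSpace ℝ V]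
    (f : EuclideanSpace ℝ (Fin d) → V) : Set (Set (EuclideanSpace ℝ (Fin d))) :=
  {R | ∃ g : EuclideanSpace ℝ (Fin d) →ᵃ[ℝ] V,
    (interior {x | f x = g x}).Nonempty ∧ R = closure (interior {x | f x = g x})}

/-- A one-dimensional CPWL path in `ℝ^d`: a continuous map on a segment `[a, b]` that is affine on
each of finitely many consecutive segments. Only the values on `[a, b]` matter. -/
structure CPWLPath (d : ℕ) where
  /-- left end of the parameter segment -/
  a : ℝ
  /-- right end of the parameter segment -/
  b : ℝ
  lt : a < b
  /-- the parametrization -/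
  toFun : ℝ → EuclideanSpace ℝ (Fin d)
  continuousOn : ContinuousOn toFun (Set.Icc a b)
  piecewise : ∃ (n : ℕ) (t : Fin (n + 1) → ℝ),
    Monotone t ∧ t 0 = a ∧ t (Fin.last n) = b ∧
      ∀ i : Fin n, ∃ p v : EuclideanSpace ℝ (Fin d),
        ∀ s ∈ Set.Icc (t i.castSucc) (t i.succ), toFun s = p + s • v

/-- The length of a path: the integral over `[a, b]` of the Euclidean norm of its derivative. -/
def CPWLPath.length {d : ℕ} (γ : CPWLPath d) : ℝ≥0∞ :=
  ∫⁻ t in Set.Icc γ.a γ.b, ‖deriv γ.toFun t‖ₑ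

/-- The characteristic function of `f` along `γ`: the vector, indexed by the projection regions of
`f`, of the indicators of these regions at the point `γ(t)`. -/
def characteristicAlong {d : ℕ} {V : Type*} [NormedAddCommGroup V] [NormedSpace ℝ V]
    (f : EuclideanSpace ℝ (Fin d) → V) (γ : CPWLPath d) (t : ℝ) : projectionRegions f → ℝ :=
  fun R => Set.indicator (R : Set (EuclideanSpace ℝ (Fin d))) (fun _ => (1 : ℝ)) (γ.toFun t)

/-- The knots of `f` along `γ`: the points of `[a, b]` at which the characteristic function, as a
function on `[a, b]`, is discontinuous. -/
def knotsAlong {d : ℕ} {V : Type*} [NormedAddCommGroup V] [NormedSpace ℝ V]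
    (f : EuclideanSpace ℝ (Fin d) → V) (γ : CPWLPath d) : Set ℝ :=
  {t | t ∈ Set.Icc γ.a γ.b ∧
    ¬ ContinuousWithinAt (characteristicAlong f γ) (Set.Icc γ.a γ.b) t}

/-- The knot density of `f` along `γ`: the number of knots divided by the length of the path
(it is `0 / 0 = 0` for a path of length zero, which is constant and has no knot). -/
def knotDensity {d : ℕ} {V : Type*} [NormedAddCommGroup V] [NormedSpace ℝ V]
    (f : EuclideanSpace ℝ (Fin d) → V) (γ : CPWLPath d) : ℝ≥0∞ :=
  ((knotsAlong f γ).encard : ℝ≥0∞) / γ.length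

/-- The composition of the first `m` layers of a network with layers `g 0, …, g (L - 1)`, where
layer `ℓ` maps `ℝ^(d ℓ)` to `ℝ^(d (ℓ + 1))`. -/
def partialComposition {L : ℕ} {d : Fin (L + 1) → ℕ}
    (g : ∀ l : Fin L, EuclideanSpace ℝ (Fin (d l.castSucc)) → EuclideanSpace ℝ (Fin (d l.succ)))
    (m : Fin (L + 1)) : EuclideanSpace ℝ (Fin (d 0)) → EuclideanSpace ℝ (Fin (d m)) :=
  Fin.induction
    (motive := fun m => EuclideanSpace ℝ (Fin (d 0)) → EuclideanSpace ℝ (Fin (d m)))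
    id (fun l F => g l ∘ F) m

end

/-! Regions of a composition are not simply related to the regions of its layers, so knots are first
recast as a local condition: t is a knot of f along γ exactly when `IsStableAt` fails, that is, when
the increments of f near γ(t) and near arbitrarily close points of γ differ
(`isStableAt_iff_regions`, `knotsAlong_eq`). Stability composes: if h is stable along c and f is
stable along h ∘ c, then f ∘ h is stable along c (`IsStableAt.comp`). Hence every knot of the
network along γ is a knot of some component of some layer ℓ along the image of γ under the preceding
layers.

That image path depends only on the earlier parameters, which are independent of θ_ℓ. Integrating
over θ_ℓ alone therefore bounds the expected number of these knots by λ₀ times the expected length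
of the image path. By Tonelli and the chain rule along γ, this length is at most max(D₀, 1) len(γ)
in expectation; the 1 covers the empty composition. Summing over L layers with at most W components
each and dividing by len(γ) gives the bound.

The integrals make sense because the number of unstable parameters is the supremum of the numbers of
grid cells they meet, and "a segment contains no unstable parameter" reduces, by compactness and
density, to countably many equations. -/

open Set Filter Topology

/-! ### Continuous selections of finitely many affine maps -/

section Selection

variable {E F V : Type*} [NormedAddCommGroup E] [NormedSpace ℝ E]
  [NormedAddCommGroup F] [NormedSpace ℝ F] [NormedAddCommGroup V] [NormedSpace ℝ V]

/-- A continuous function whose value at every point is that of one of finitely many affine maps. -/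
def IsAffineSelection (f : E → V) : Prop :=
  Continuous f ∧ ∃ G : Set (E →ᵃ[ℝ] V), G.Finite ∧ ∀ x, ∃ g ∈ G, f x = g x

theorem isAffineSelection_id : IsAffineSelection (id : E → E) :=
  ⟨continuous_id, {AffineMap.id ℝ E}, finite_singleton _, fun _ => ⟨_, rfl, rfl⟩⟩

/-- This closure property is why selections replace CPWL decompositions: the pairwise composites of
the affine pieces suffice, and no cells have to be rebuilt. -/
theorem IsAffineSelection.comp {f : F → V} {h : E → F} (hf : IsAffineSelection f)
    (hh : IsAffineSelection h) : IsAffineSelection (f ∘ h) := by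
  obtain ⟨hfc, G, hG, hfG⟩ := hf
  obtain ⟨hhc, H, hH, hhH⟩ := hh
  refine ⟨hfc.comp hhc, image2 AffineMap.comp G H, hG.image2 _ hH, fun x => ?_⟩
  obtain ⟨k, hk, hkx⟩ := hhH x
  obtain ⟨g, hg, hgx⟩ := hfG (h x)
  exact ⟨g.comp k, mem_image2_of_mem hg hk, by simp [hgx, ← hkx]⟩

theorem IsCPWL.isAffineSelection {d : ℕ} {f : EuclideanSpace ℝ (Fin d) → V} (hf : IsCPWL f) :
    IsAffineSelection f := by
  obtain ⟨hc, K, g, R, -, -, -, hU, hR⟩ := hf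
  refine ⟨hc, range g, finite_range g, fun x => ?_⟩
  obtain ⟨k, hk⟩ := mem_iUnion.1 (hU ▸ mem_univ x)
  exact ⟨g k, mem_range_self k, hR k x hk⟩

theorem IsAffineSelection.apply {d : ℕ} {f : E → EuclideanSpace ℝ (Fin d)}
    (hf : IsAffineSelection f) (k : Fin d) : IsAffineSelection (fun x => f x k) := by
  refine IsAffineSelection.comp (f := fun y : EuclideanSpace ℝ (Fin d) => y k) ?_ hf
  exact ⟨by fun_prop, {(EuclideanSpace.proj k : EuclideanSpace ℝ (Fin d) →L[ℝ] ℝ).toAffineMap},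
    finite_singleton _, fun _ => ⟨_, rfl, rfl⟩⟩

omit [NormedSpace ℝ V] in
/-- A continuous function with finitely many values on a segment has the same values at its ends. -/
theorem eq_of_continuousOn_of_finite_values {a b : ℝ} {φ : ℝ → V} {S T : Set _}
    (hS : IsPreconnected S) (hφ : ContinuousOn φ S) (hT : T.Finite) (hm : MapsTo φ S T)
    (ha : a ∈ S) (hb : b ∈ S) : φ a = φ b :=
  hS.constant_of_mapsTo hT.isDiscrete hφ hm ha hb

/-- A curve that is affine on a one-sided neighbourhood of every parameter, on both sides. -/
def GermAffine (c : ℝ → E) : Prop :=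
  ∀ s u : ℝ, ∃ p : E, ∀ᶠ τ in 𝓝[>] (0 : ℝ), c (s + τ * u) = c s + τ • p

theorem affineMap_add_smul (g : E →ᵃ[ℝ] V) (x u : E) (τ : ℝ) :
    g (x + τ • u) = g x + τ • g.linear u := by
  have := g.map_vadd x (τ • u)
  simp only [vadd_eq_add, map_smul] at this
  rw [add_comm x, this, add_comm]

variable [FiniteDimensional ℝ E]

/-- Close to x only the pieces agreeing with f at x can be active, so the difference quotient along
the ray takes finitely many values `g.linear u`; being continuous on an interval, it is constant. -/
theorem IsAffineSelection.exists_slope {f : E → V} (hf : IsAffineSelection f) (x u : E) :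
    ∃ p : V, ∀ᶠ τ in 𝓝[>] (0 : ℝ), f (x + τ • u) = f x + τ • p := by
  obtain ⟨hc, G, hG, hfG⟩ := hf
  have h1 : ∀ᶠ τ in 𝓝[>] (0 : ℝ), ∀ g ∈ G, f (x + τ • u) = g (x + τ • u) → f x = g x := by
    rw [hG.eventually_all]
    intro g _
    by_cases hg : f x = g x
    · exact Eventually.of_forall fun _ _ => hg
    · have hgc := g.continuous_of_finiteDimensional
      have : ∀ᶠ τ in 𝓝 (0 : ℝ), f (x + τ • u) ≠ g (x + τ • u) := by
        have hcd : Continuous fun τ : ℝ => f (x + τ • u) - g (x + τ • u) := by fun_prop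
        filter_upwards [hcd.continuousAt.eventually_ne (x := 0) (y := 0)
          (by simpa [sub_eq_zero] using hg)] with τ hτ
        simpa [sub_eq_zero] using hτ
      exact (this.filter_mono nhdsWithin_le_nhds).mono fun τ h h' => absurd h' h
  obtain ⟨ε, hε, hsub⟩ := mem_nhdsGT_iff_exists_Ioo_subset.1 h1
  have hε : (0 : ℝ) < ε := hε
  set φ : ℝ → V := fun τ => τ⁻¹ • (f (x + τ • u) - f x) with hφ
  have hmaps : MapsTo φ (Ioo 0 ε) ((fun g : E →ᵃ[ℝ] V => g.linear u) '' G) := by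
    intro τ hτ
    obtain ⟨g, hg, hgx⟩ := hfG (x + τ • u)
    refine ⟨g, hg, ?_⟩
    have h2 := hsub hτ g hg hgx
    simp only [hφ]
    rw [hgx, h2, affineMap_add_smul, add_sub_cancel_left, smul_smul,
      inv_mul_cancel₀ hτ.1.ne', one_smul]
  have hcont : ContinuousOn φ (Ioo 0 ε) := by
    refine ContinuousOn.smul (continuousOn_inv₀.mono fun τ hτ => hτ.1.ne') ?_
    exact Continuous.continuousOn (by fun_prop)
  refine ⟨φ (ε / 2), ?_⟩
  filter_upwards [Ioo_mem_nhdsGT hε] with τ hτ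
  have := eq_of_continuousOn_of_finite_values isPreconnected_Ioo hcont (hG.image _) hmaps hτ
    (⟨by positivity, by linarith⟩ : ε / 2 ∈ Ioo 0 ε)
  rw [← this, hφ]
  simp only
  rw [smul_smul, mul_inv_cancel₀ hτ.1.ne', one_smul]
  abel

theorem IsAffineSelection.germAffine_comp {f : E → V} (hf : IsAffineSelection f) {c : ℝ → E}
    (hc : GermAffine c) : GermAffine (f ∘ c) := by
  intro s u
  obtain ⟨p, hp⟩ := hc s u
  obtain ⟨q, hq⟩ := hf.exists_slope (c s) p
  refine ⟨q, ?_⟩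
  filter_upwards [hp, hq] with τ h1 h2
  simp [h1, h2]

/-! ### Parameters at which a function is locally translation-invariant along a curve -/

/-- Near `c t`, the function `f` is, up to a constant, invariant under the translations that carry
`c t` to the nearby points of the curve `c`. -/
def IsStableAt (f : E → V) (c : ℝ → E) (t : ℝ) : Prop :=
  ∀ᶠ q : ℝ × E in 𝓝 (t, 0), f (c q.1 + q.2) - f (c q.1) = f (c t + q.2) - f (c t)

omit [NormedSpace ℝ E] [NormedSpace ℝ V] [FiniteDimensional ℝ E] in
theorem isStableAt_id (c : ℝ → E) (t : ℝ) : IsStableAt id c t :=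
  Eventually.of_forall fun q => by simp

-- The increment of h at `c t` equals its increment at the nearby `c s` and tends to 0 with the
-- displacement, so it can serve as the displacement in the stability of f along `h ∘ c`.
omit [NormedSpace ℝ E] [NormedSpace ℝ V] [FiniteDimensional ℝ E] [NormedSpace ℝ F] in
theorem IsStableAt.comp {f : F → V} {h : E → F} {c : ℝ → E} {t : ℝ} (hh : Continuous h)
    (h1 : IsStableAt h c t) (h2 : IsStableAt f (h ∘ c) t) : IsStableAt (f ∘ h) c t := by
  have hlim : Tendsto (fun q : ℝ × E => (q.1, h (c t + q.2) - h (c t))) (𝓝 (t, 0)) (𝓝 (t, 0)) := by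
    have : Continuous fun q : ℝ × E => (q.1, h (c t + q.2) - h (c t)) := by fun_prop
    simpa using this.tendsto (t, 0)
  filter_upwards [h1, hlim.eventually h2] with q hq1 hq2
  simp only [Function.comp_apply] at hq2 ⊢
  rw [add_sub_cancel, ← hq1, add_sub_cancel] at hq2
  exact hq2

omit [NormedSpace ℝ E] [FiniteDimensional ℝ E] in
theorem isStableAt_of_forall_apply {n : ℕ} {f : E → EuclideanSpace ℝ (Fin n)} {c : ℝ → E} {t : ℝ}
    (h : ∀ k, IsStableAt (fun x => f x k) c t) : IsStableAt f c t := by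
  have := eventually_all.2 h
  filter_upwards [this] with q hq
  ext k
  simpa using hq k

/-- The closure of the set where `f` locally coincides with `g`. -/
def pieceRegion (f : E → V) (g : E →ᵃ[ℝ] V) : Set E := closure (interior {x | f x = g x})

theorem isClosed_setOf_eq_affine {f : E → V} (hf : Continuous f) (g : E →ᵃ[ℝ] V) :
    IsClosed {x | f x = g x} :=
  isClosed_eq hf g.continuous_of_finiteDimensional

theorem eq_of_mem_pieceRegion {f : E → V} (hf : Continuous f) {g : E →ᵃ[ℝ] V} {x : E}
    (hx : x ∈ pieceRegion f g) : f x = g x :=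
  (isClosed_setOf_eq_affine hf g).closure_interior_subset hx

/-- By Baire, the interiors of the members of a finite closed cover have dense union, and closure
commutes with finite unions. -/
theorem exists_mem_pieceRegion {f : E → V} (hf : Continuous f) {G : Set (E →ᵃ[ℝ] V)}
    (hG : G.Finite) (hfG : ∀ x, ∃ g ∈ G, f x = g x) (x : E) : ∃ g ∈ G, x ∈ pieceRegion f g := by
  have : CompleteSpace E := FiniteDimensional.complete ℝ E
  have hd := dense_biUnion_interior_of_closed (S := G) (f := fun g => {x | f x = g x})
    (fun g _ => isClosed_setOf_eq_affine hf g) hG.countable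
    (by ext x; simpa using hfG x)
  have hx := hd x
  rw [hG.closure_biUnion] at hx
  simpa [pieceRegion] using hx

/-- Every piece g active near x = `c t` has x in its region, hence also x + w = `c s`, so g has
increment f(x + w) - f(x) along w. On the segment from x + v to x + v + w, subtracting this common
linear part from f leaves only the values g(x + v), finitely many; by continuity the difference is
constant. -/
theorem isStableAt_of_regions {f : E → V} (hf : IsAffineSelection f) {c : ℝ → E}
    (hc : Continuous c) {t : ℝ}
    (h : ∀ g : E →ᵃ[ℝ] V, ∀ᶠ s in 𝓝 t, (c s ∈ pieceRegion f g ↔ c t ∈ pieceRegion f g)) :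
    IsStableAt f c t := by
  obtain ⟨hfc, G, hG, hfG⟩ := hf
  have h1 : ∀ᶠ s in 𝓝 t, ∀ g ∈ G, (c s ∈ pieceRegion f g ↔ c t ∈ pieceRegion f g) :=
    (hG.eventually_all).2 fun g _ => h g
  have h2 : ∀ᶠ y in 𝓝 (c t), ∀ g ∈ G, y ∈ pieceRegion f g → c t ∈ pieceRegion f g := by
    refine (hG.eventually_all).2 fun g _ => ?_
    by_cases hx : c t ∈ pieceRegion f g
    · exact Eventually.of_forall fun _ _ => hx
    · filter_upwards [(isClosed_closure.isOpen_compl).mem_nhds hx] with y hy hy'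
      exact absurd hy' hy
  obtain ⟨r, hr, hball⟩ := Metric.eventually_nhds_iff_ball.1 h2
  have h3 : ∀ᶠ s in 𝓝 t, c s ∈ Metric.ball (c t) (r / 2) :=
    hc.continuousAt (Metric.ball_mem_nhds _ (by positivity))
  have h4 : ∀ᶠ v in 𝓝 (0 : E), v ∈ Metric.ball (0 : E) (r / 2) :=
    Metric.ball_mem_nhds _ (by positivity)
  rw [IsStableAt, nhds_prod_eq]
  filter_upwards [(h1.and h3).prod_mk h4] with q ⟨⟨hq1, hq2⟩, hq3⟩
  set x := c t
  set w := c q.1 - x with hw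
  have hcq : c q.1 = x + w := by simp [hw]
  have hwr : ‖w‖ < r / 2 := by simpa [hw, dist_eq_norm] using hq2
  have hvr : ‖q.2‖ < r / 2 := by simpa using hq3
  rw [hcq] at hq1 ⊢
  set φ : ℝ → V := fun τ => f ((x + q.2) + τ • w) - τ • (f (x + w) - f x) with hφ
  have hmaps : MapsTo φ (Icc 0 1) ((fun g : E →ᵃ[ℝ] V => g (x + q.2)) '' G) := by
    intro τ hτ
    obtain ⟨g, hg, hy⟩ := exists_mem_pieceRegion hfc hG hfG ((x + q.2) + τ • w)
    refine ⟨g, hg, ?_⟩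
    have hyb : (x + q.2) + τ • w ∈ Metric.ball x r := by
      rw [Metric.mem_ball, dist_eq_norm, add_assoc, add_sub_cancel_left]
      calc ‖q.2 + τ • w‖ ≤ ‖q.2‖ + ‖τ • w‖ := norm_add_le _ _
        _ ≤ ‖q.2‖ + ‖w‖ := by
          rw [norm_smul, Real.norm_of_nonneg hτ.1]
          gcongr
          exact mul_le_of_le_one_left (norm_nonneg _) hτ.2
        _ < r := by linarith
    have hx := hball _ hyb g hg hy
    have e1 := eq_of_mem_pieceRegion hfc hx
    have e2 := eq_of_mem_pieceRegion hfc ((hq1 g hg).2 hx)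
    have e3 := eq_of_mem_pieceRegion hfc hy
    have e4 := affineMap_add_smul g x w 1
    rw [one_smul, one_smul] at e4
    simp only [hφ]
    rw [e3, affineMap_add_smul, e1, e2, e4]
    simp
  have := eq_of_continuousOn_of_finite_values (a := 1) (b := 0) isPreconnected_Icc
    (Continuous.continuousOn (by fun_prop)) (hG.image _) hmaps (by simp) (by simp)
  simp only [hφ, one_smul, zero_smul, add_zero, sub_zero] at this
  rw [show x + w + q.2 = x + q.2 + w by abel, sub_eq_sub_iff_sub_eq_sub, ← this]
  abel

-- Stability gives f(y + τp) = f(y) + τq for all y in a fixed ball about x. If the open set where f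
-- locally equals g meets this ball, then g has slope q along p, so translation by τp carries that
-- set to itself near x, and its closure too. Otherwise neither x nor x + τp lies in the region.
omit [FiniteDimensional ℝ E] in
theorem IsStableAt.regions_eventually_of_slope {f : E → V} {c : ℝ → E} {t u : ℝ}
    (h : IsStableAt f c t) {p : E} (hp : ∀ᶠ τ in 𝓝[>] (0 : ℝ), c (t + τ * u) = c t + τ • p)
    {q : V} (hq : ∀ᶠ τ in 𝓝[>] (0 : ℝ), f (c (t + τ * u)) = f (c t) + τ • q)
    (g : E →ᵃ[ℝ] V) :
    ∀ᶠ τ in 𝓝[>] (0 : ℝ), (c (t + τ * u) ∈ pieceRegion f g ↔ c t ∈ pieceRegion f g) := by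
  set x := c t
  set O := interior {x | f x = g x} with hO
  rw [IsStableAt, nhds_prod_eq] at h
  obtain ⟨P1, hP1, P2, hP2, hPP⟩ := eventually_prod_iff.1 h
  obtain ⟨δ, hδ, hball⟩ := Metric.eventually_nhds_iff_ball.1 hP2
  have hlim : Tendsto (fun τ : ℝ => t + τ * u) (𝓝[>] 0) (𝓝 t) := by
    have : Continuous fun τ : ℝ => t + τ * u := by fun_prop
    simpa using (this.tendsto 0).mono_left nhdsWithin_le_nhds
  have hlimp : ∀ y : E, Tendsto (fun τ : ℝ => y + τ • p) (𝓝[>] 0) (𝓝 y) := by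
    intro y
    have : Continuous fun τ : ℝ => y + τ • p := by fun_prop
    simpa using (this.tendsto 0).mono_left nhdsWithin_le_nhds
  have key : ∀ᶠ τ in 𝓝[>] (0 : ℝ), ∀ y ∈ Metric.ball x δ, f (y + τ • p) = f y + τ • q := by
    filter_upwards [hlim.eventually hP1, hp, hq] with τ h1 h2 h3 y hy
    have h4 := hPP h1 (hball (y - x) (by simpa [dist_eq_norm] using hy))
    simp only at h4
    rw [h3, h2, add_sub_cancel, sub_eq_sub_iff_sub_eq_sub] at h4
    rw [show y + τ • p = x + τ • p + (y - x) by abel]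
    rw [add_sub_cancel_left] at h4
    exact sub_eq_iff_eq_add'.1 h4
  have hnear : ∀ᶠ τ in 𝓝[>] (0 : ℝ), x + τ • p ∈ Metric.ball x δ :=
    (hlimp x).eventually (Metric.ball_mem_nhds x hδ)
  by_cases hne : (O ∩ Metric.ball x δ).Nonempty
  · obtain ⟨y, hyO, hyb⟩ := hne
    have hslope : q = g.linear p := by
      have h5 : ∀ᶠ τ in 𝓝[>] (0 : ℝ), y + τ • p ∈ O :=
        (hlimp y).eventually (isOpen_interior.mem_nhds hyO)
      obtain ⟨τ, ⟨h5, h6⟩, hτ⟩ := ((h5.and key).and self_mem_nhdsWithin).exists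
      have h7 : y ∈ {x | f x = g x} := interior_subset hyO
      have h8 : y + τ • p ∈ {x | f x = g x} := interior_subset h5
      change f y = g y at h7
      change f _ = g _ at h8
      rw [h6 y hyb, affineMap_add_smul, h7, add_right_inj] at h8
      exact smul_right_injective V (ne_of_gt hτ) h8
    filter_upwards [key, hp, hnear] with τ h1 h2 h3
    rw [h2]
    have hiff : ∀ z ∈ Metric.ball x δ, (z + τ • p ∈ O ↔ z ∈ O) := by
      intro z hz
      rw [hO, mem_interior_iff_mem_nhds, mem_interior_iff_mem_nhds, ← map_add_right_nhds,
        Filter.mem_map]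
      refine Filter.eventually_congr (p := fun y => f (y + τ • p) = g (y + τ • p))
        (q := fun y => f y = g y) ?_
      filter_upwards [Metric.isOpen_ball.mem_nhds hz] with y hy
      rw [h1 y hy, affineMap_add_smul, hslope, add_left_inj]
    rw [pieceRegion, mem_closure_iff_frequently, mem_closure_iff_frequently,
      ← map_add_right_nhds, Filter.frequently_map]
    refine frequently_congr ?_
    filter_upwards [Metric.ball_mem_nhds x hδ] with z hz using hiff z hz
  · have hnot : ∀ z ∈ Metric.ball x δ, z ∉ pieceRegion f g := by
      intro z hz hzc
      obtain ⟨y, hy1, hy2⟩ := mem_closure_iff.1 hzc _ Metric.isOpen_ball hz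
      exact hne ⟨y, hy2, hy1⟩
    filter_upwards [hp, hnear] with τ h2 h3
    rw [h2]
    exact iff_of_false (hnot _ h3) (hnot _ (Metric.mem_ball_self hδ))

theorem eventually_nhds_of_rays {P : ℝ → Prop} {t : ℝ} (h0 : P t)
    (hr : ∀ᶠ τ in 𝓝[>] (0 : ℝ), P (t + τ * 1)) (hl : ∀ᶠ τ in 𝓝[>] (0 : ℝ), P (t + τ * (-1))) :
    ∀ᶠ s in 𝓝 t, P s := by
  obtain ⟨ε, hε, h1⟩ := mem_nhdsGT_iff_exists_Ioo_subset.1 hr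
  obtain ⟨ε', hε', h2⟩ := mem_nhdsGT_iff_exists_Ioo_subset.1 hl
  have hε : (0 : ℝ) < ε := hε
  have hε' : (0 : ℝ) < ε' := hε'
  filter_upwards [Ioo_mem_nhds (show t - ε' < t by linarith) (show t < t + ε by linarith)] with s hs
  rcases lt_trichotomy s t with hst | rfl | hst
  · have : P (t + (t - s) * (-1)) := h2 (show t - s ∈ Ioo 0 ε' from ⟨by linarith, by linarith [hs.1]⟩)
    convert this using 1
    ring
  · exact h0
  · have : P (t + (s - t) * 1) := h1 (show s - t ∈ Ioo 0 ε from ⟨by linarith, by linarith [hs.2]⟩)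
    convert this using 1
    ring

theorem isStableAt_iff_regions {f : E → V} (hf : IsAffineSelection f) {c : ℝ → E}
    (hc : Continuous c) (hg : GermAffine c) {t : ℝ} :
    IsStableAt f c t ↔
      ∀ g : E →ᵃ[ℝ] V, ∀ᶠ s in 𝓝 t, (c s ∈ pieceRegion f g ↔ c t ∈ pieceRegion f g) := by
  refine ⟨fun h g => ?_, isStableAt_of_regions hf hc⟩
  suffices hray : ∀ u : ℝ, ∀ᶠ τ in 𝓝[>] (0 : ℝ),
      (c (t + τ * u) ∈ pieceRegion f g ↔ c t ∈ pieceRegion f g) from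
    eventually_nhds_of_rays Iff.rfl (hray 1) (hray (-1))
  intro u
  obtain ⟨p, hp⟩ := hg t u
  obtain ⟨q, hq⟩ := hf.germAffine_comp hg t u
  exact h.regions_eventually_of_slope hp hq g

end Selection

/-! ### CPWL paths -/

section Paths

variable {E : Type*} [NormedAddCommGroup E] [NormedSpace ℝ E]

theorem Fin.exists_castSucc_and_not_succ {n : ℕ} {p : Fin (n + 1) → Prop} (h0 : p 0)
    (hn : ¬ p (Fin.last n)) : ∃ i : Fin n, p i.castSucc ∧ ¬ p i.succ := by
  by_contra! h
  exact hn (Fin.induction h0 h (Fin.last n))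

theorem GermAffine.of_sides {c : ℝ → E}
    (hr : ∀ s, ∃ p, ∀ᶠ τ in 𝓝[>] (0 : ℝ), c (s + τ) = c s + τ • p)
    (hl : ∀ s, ∃ p, ∀ᶠ τ in 𝓝[>] (0 : ℝ), c (s - τ) = c s + τ • p) : GermAffine c := by
  have hlim : ∀ u : ℝ, 0 < u → Tendsto (fun τ : ℝ => τ * u) (𝓝[>] 0) (𝓝[>] 0) := by
    intro u hu
    refine tendsto_nhdsWithin_iff.2 ⟨?_, ?_⟩
    · have : Continuous fun τ : ℝ => τ * u := by fun_prop
      simpa using (this.tendsto 0).mono_left nhdsWithin_le_nhds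
    · filter_upwards [self_mem_nhdsWithin] with τ hτ using mul_pos hτ hu
  intro s u
  rcases lt_trichotomy u 0 with hu | rfl | hu
  · obtain ⟨p, hp⟩ := hl s
    refine ⟨(-u) • p, ?_⟩
    filter_upwards [(hlim (-u) (by linarith)).eventually hp] with τ hτ
    rw [smul_smul, ← hτ]
    congr 1
    ring
  · exact ⟨0, by simp⟩
  · obtain ⟨p, hp⟩ := hr s
    refine ⟨u • p, ?_⟩
    filter_upwards [(hlim u hu).eventually hp] with τ hτ
    rw [smul_smul, ← hτ]

theorem GermAffine.exists_pos_segment {c : ℝ → E} (hg : GermAffine c) (s u : ℝ) :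
    ∃ ε > 0, ∃ p : E, ∀ τ ∈ Ico (0 : ℝ) ε, c (s + τ * u) = c s + τ • p := by
  obtain ⟨p, hp⟩ := hg s u
  obtain ⟨ε, hε, h⟩ := mem_nhdsGT_iff_exists_Ioo_subset.1 hp
  refine ⟨ε, hε, p, fun τ hτ => ?_⟩
  rcases hτ.1.eq_or_lt with rfl | h0
  · simp
  · exact h ⟨h0, hτ.2⟩

/-- Each s has a neighbourhood on which c is affine on either side of s. By compactness a finite
partition has each interval inside the neighbourhood of some z; cutting the interval at z makes both
parts affine. -/
theorem GermAffine.exists_partition {c : ℝ → E} (hg : GermAffine c) {a b : ℝ} (hab : a ≤ b) :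
    ∃ (n : ℕ) (t : Fin (n + 1) → ℝ), Monotone t ∧ t 0 = a ∧ t (Fin.last n) = b ∧
      ∀ i : Fin n, ∃ p v : E, ∀ s ∈ Icc (t i.castSucc) (t i.succ), c s = p + s • v := by
  choose ε hε p hp using fun s => hg.exists_pos_segment s 1
  choose ε' hε' q hq using fun s => hg.exists_pos_segment s (-1)
  obtain ⟨t, ht0, htm, ⟨m, hm⟩, hcov⟩ := exists_monotone_Icc_subset_open_cover_Icc hab
    (c := fun s : ℝ => {x : Icc a b | (x : ℝ) ∈ Ioo (s - ε' s) (s + ε s)})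
    (fun s => isOpen_Ioo.preimage continuous_subtype_val)
    (fun x _ => mem_iUnion.2 ⟨x, ⟨by linarith [hε' x], by linarith [hε x]⟩⟩)
  choose z hz using hcov
  have hle : ∀ k, (t k : ℝ) ≤ t (k + 1) := fun k => htm (Nat.le_succ k)
  have hIoo : ∀ k, ∀ s ∈ Icc (t k : ℝ) (t (k + 1)), s ∈ Ioo (z k - ε' (z k)) (z k + ε (z k)) := by
    intro k s hs
    exact @hz k ⟨s, (t k).2.1.trans hs.1, hs.2.trans (t (k + 1)).2.2⟩ ⟨hs.1, hs.2⟩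
  have hright : ∀ k, ∀ s ∈ Icc (t k : ℝ) (t (k + 1)), z k ≤ s →
      c s = (c (z k) - z k • p (z k)) + s • p (z k) := by
    intro k s hs hzs
    have := hp (z k) (s - z k) ⟨by linarith, by linarith [(hIoo k s hs).2]⟩
    rw [mul_one, add_sub_cancel] at this
    rw [this, sub_smul]
    abel
  have hleft : ∀ k, ∀ s ∈ Icc (t k : ℝ) (t (k + 1)), s ≤ z k →
      c s = (c (z k) + z k • q (z k)) + s • (-q (z k)) := by
    intro k s hs hzs
    have := hq (z k) (z k - s) ⟨by linarith, by linarith [(hIoo k s hs).1]⟩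
    rw [show z k + (z k - s) * -1 = s by ring] at this
    rw [this, sub_smul, smul_neg]
    abel
  -- The cut point z k is clamped to its interval, since the centre of a covering neighbourhood may
  -- lie outside it.
  set w : ℕ → ℝ := fun k => max (t k) (min (t (k + 1)) (z k)) with hw
  have hw1 : ∀ k, (t k : ℝ) ≤ w k := fun k => le_max_left _ _
  have hw2 : ∀ k, w k ≤ t (k + 1) := fun k => max_le (hle k) (min_le_left _ _)
  -- The refined partition interleaves the nodes t k (even indices) with the cuts w k (odd indices).
  set r : ℕ → ℝ := fun j => if Even j then t (j / 2) else w (j / 2) with hr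
  have hre : ∀ k, r (2 * k) = t k := fun k => by simp [hr]
  have hro : ∀ k, r (2 * k + 1) = w k := fun k => by
    have : (2 * k + 1) / 2 = k := by omega
    simp [hr, this]
  have hro' : ∀ k, r (2 * k + 1 + 1) = t (k + 1) := fun k => hre (k + 1)
  have hrm : Monotone r := by
    refine monotone_nat_of_le_succ fun j => ?_
    obtain ⟨k, rfl | rfl⟩ := j.even_or_odd'
    · rw [hre, hro]; exact hw1 k
    · rw [hro, hro']; exact hw2 k
  refine ⟨2 * m, fun i => r i, fun i j hij => hrm hij, ?_, ?_, ?_⟩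
  · simpa [hr] using ht0
  · simpa [hre] using hm m le_rfl
  · rintro ⟨i, hi⟩
    simp only [Fin.castSucc_mk, Fin.succ_mk]
    obtain ⟨k, rfl | rfl⟩ := i.even_or_odd'
    · rw [hre, hro]
      by_cases hk : z k ≤ t k
      · exact ⟨_, _, fun s hs => hright k s ⟨hs.1, hs.2.trans (hw2 k)⟩ (hk.trans hs.1)⟩
      · refine ⟨_, _, fun s hs => hleft k s ⟨hs.1, hs.2.trans (hw2 k)⟩ (hs.2.trans ?_)⟩
        exact max_le (not_le.1 hk).le (min_le_right _ _)
    · rw [hro, hro']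
      by_cases hk : z k ≤ t (k + 1)
      · refine ⟨_, _, fun s hs => hright k s ⟨(hw1 k).trans hs.1, hs.2⟩ (le_trans ?_ hs.1)⟩
        exact (min_eq_right hk).symm.le.trans (le_max_right _ _)
      · exact ⟨_, _, fun s hs => hleft k s ⟨(hw1 k).trans hs.1, hs.2⟩
          (hs.2.trans (not_le.1 hk).le)⟩

end Paths

namespace CPWLPath

variable {d : ℕ}

/-- The extension of a path to the real line that is constant on both sides of `[a, b]`. -/
noncomputable def extend (γ : CPWLPath d) (t : ℝ) : EuclideanSpace ℝ (Fin d) :=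
  γ.toFun (projIcc γ.a γ.b γ.lt.le t)

theorem extend_of_mem (γ : CPWLPath d) {t : ℝ} (ht : t ∈ Icc γ.a γ.b) :
    γ.extend t = γ.toFun t := by
  rw [extend, projIcc_of_mem _ ht]

theorem extend_of_le_left (γ : CPWLPath d) {t : ℝ} (ht : t ≤ γ.a) : γ.extend t = γ.toFun γ.a := by
  rw [extend, projIcc_of_le_left _ ht]

theorem extend_of_right_le (γ : CPWLPath d) {t : ℝ} (ht : γ.b ≤ t) :
    γ.extend t = γ.toFun γ.b := by
  rw [extend, projIcc_of_right_le _ ht]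

theorem continuous_extend (γ : CPWLPath d) : Continuous γ.extend :=
  γ.continuousOn.comp_continuous (continuous_subtype_val.comp continuous_projIcc)
    fun t => (projIcc γ.a γ.b γ.lt.le t).2

theorem extend_eventuallyEq (γ : CPWLPath d) {t : ℝ} (ht : t ∉ Icc γ.a γ.b) :
    ∀ᶠ s in 𝓝 t, γ.extend s = γ.extend t := by
  rw [mem_Icc, not_and_or, not_le, not_le] at ht
  rcases ht with ht | ht
  · filter_upwards [Iio_mem_nhds ht] with s hs
    rw [γ.extend_of_le_left (le_of_lt hs), γ.extend_of_le_left ht.le]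
  · filter_upwards [Ioi_mem_nhds ht] with s hs
    rw [γ.extend_of_right_le (le_of_lt hs), γ.extend_of_right_le ht.le]

theorem germAffine_extend (γ : CPWLPath d) : GermAffine γ.extend := by
  obtain ⟨n, t, htm, ht0, htn, haff⟩ := γ.piecewise
  have hmem : ∀ i : Fin n, Icc (t i.castSucc) (t i.succ) ⊆ Icc γ.a γ.b := fun i =>
    Icc_subset_Icc (ht0 ▸ htm (Fin.zero_le _)) (htn ▸ htm (Fin.le_last _))
  refine GermAffine.of_sides (fun s => ?_) (fun s => ?_)
  · rcases lt_or_ge s γ.a with hs | hs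
    · refine ⟨0, ?_⟩
      filter_upwards [Ioo_mem_nhdsGT (sub_pos.2 hs)] with τ hτ
      rw [γ.extend_of_le_left hs.le, γ.extend_of_le_left (by linarith [hτ.2])]
      simp
    rcases le_or_gt γ.b s with hs' | hs'
    · refine ⟨0, ?_⟩
      filter_upwards [self_mem_nhdsWithin] with τ hτ
      have hτ : 0 < τ := hτ
      rw [γ.extend_of_right_le hs', γ.extend_of_right_le (by linarith)]
      simp
    obtain ⟨i, hi1, hi2⟩ := Fin.exists_castSucc_and_not_succ (p := fun i => t i ≤ s)
      (ht0.trans_le hs) (by rw [htn]; exact not_le.2 hs')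
    obtain ⟨p, v, hpv⟩ := haff i
    rw [not_le] at hi2
    refine ⟨v, ?_⟩
    filter_upwards [Ioo_mem_nhdsGT (sub_pos.2 hi2)] with τ hτ
    have h1 : s ∈ Icc (t i.castSucc) (t i.succ) := ⟨hi1, hi2.le⟩
    have h2 : s + τ ∈ Icc (t i.castSucc) (t i.succ) := ⟨by linarith [hτ.1], by linarith [hτ.2]⟩
    rw [γ.extend_of_mem (hmem i h1), γ.extend_of_mem (hmem i h2), hpv _ h1, hpv _ h2, add_smul]
    abel
  · rcases le_or_gt s γ.a with hs | hs
    · refine ⟨0, ?_⟩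
      filter_upwards [self_mem_nhdsWithin] with τ hτ
      have hτ : 0 < τ := hτ
      rw [γ.extend_of_le_left hs, γ.extend_of_le_left (by linarith)]
      simp
    rcases lt_or_ge γ.b s with hs' | hs'
    · refine ⟨0, ?_⟩
      filter_upwards [Ioo_mem_nhdsGT (sub_pos.2 hs')] with τ hτ
      rw [γ.extend_of_right_le hs'.le, γ.extend_of_right_le (by linarith [hτ.2])]
      simp
    -- A strict inequality here, unlike on the right side, selects a segment with room to the left
    -- of s.
    obtain ⟨i, hi1, hi2⟩ := Fin.exists_castSucc_and_not_succ (p := fun i => t i < s)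
      (ht0.trans_lt hs) (by rw [htn]; exact not_lt.2 hs')
    obtain ⟨p, v, hpv⟩ := haff i
    rw [not_lt] at hi2
    refine ⟨-v, ?_⟩
    filter_upwards [Ioo_mem_nhdsGT (sub_pos.2 hi1)] with τ hτ
    have h1 : s ∈ Icc (t i.castSucc) (t i.succ) := ⟨hi1.le, hi2⟩
    have h2 : s - τ ∈ Icc (t i.castSucc) (t i.succ) := ⟨by linarith [hτ.2], by linarith [hτ.1]⟩
    rw [γ.extend_of_mem (hmem i h1), γ.extend_of_mem (hmem i h2), hpv _ h1, hpv _ h2, sub_smul,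
      smul_neg]
    abel

/-- The image of a path under a continuous selection of affine maps. -/
noncomputable def map {d' : ℕ} (γ : CPWLPath d) {F : EuclideanSpace ℝ (Fin d) → EuclideanSpace ℝ (Fin d')}
    (hF : IsAffineSelection F) : CPWLPath d' where
  a := γ.a
  b := γ.b
  lt := γ.lt
  toFun := F ∘ γ.toFun
  continuousOn := hF.1.comp_continuousOn γ.continuousOn
  piecewise := by
    obtain ⟨n, t, htm, ht0, htn, h⟩ :=
      (hF.germAffine_comp γ.germAffine_extend).exists_partition γ.lt.le
    refine ⟨n, t, htm, ht0, htn, fun i => ?_⟩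
    obtain ⟨p, v, hpv⟩ := h i
    refine ⟨p, v, fun s hs => ?_⟩
    have hmem : s ∈ Icc γ.a γ.b :=
      Icc_subset_Icc (ht0 ▸ htm (Fin.zero_le _)) (htn ▸ htm (Fin.le_last _)) hs
    rw [← hpv s hs, Function.comp_apply, Function.comp_apply, γ.extend_of_mem hmem]

/-- Off finitely many parameters, a path is locally affine, with finitely many velocities. -/
theorem exists_finite_locally_affine (γ : CPWLPath d) :
    ∃ B : Set ℝ, B.Finite ∧ ∃ T : Set (EuclideanSpace ℝ (Fin d)), T.Finite ∧
      ∀ s ∈ Icc γ.a γ.b \ B, ∃ v ∈ T, ∀ᶠ r in 𝓝 s, γ.toFun r = γ.toFun s + (r - s) • v := by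
  obtain ⟨n, t, htm, ht0, htn, haff⟩ := γ.piecewise
  choose p v hpv using haff
  refine ⟨range t, finite_range t, range v, finite_range v, fun s hs => ?_⟩
  obtain ⟨i, hi1, hi2⟩ := Fin.exists_castSucc_and_not_succ (p := fun i => t i ≤ s)
    (ht0.trans_le hs.1.1) (fun h => hs.2 ⟨Fin.last n, le_antisymm h (htn ▸ hs.1.2)⟩)
  rw [not_le] at hi2
  have hi1 : t i.castSucc < s := lt_of_le_of_ne hi1 fun h => hs.2 ⟨_, h⟩
  refine ⟨v i, mem_range_self i, ?_⟩
  filter_upwards [Ioo_mem_nhds hi1 hi2] with r hr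
  rw [hpv i r ⟨hr.1.le, hr.2.le⟩, hpv i s ⟨hi1.le, hi2.le⟩, sub_smul]
  abel

theorem hasDerivAt_of_locally_affine {E : Type*} [NormedAddCommGroup E] [NormedSpace ℝ E]
    {c : ℝ → E} {s : ℝ} {v : E} (h : ∀ᶠ r in 𝓝 s, c r = c s + (r - s) • v) : HasDerivAt c v s := by
  have : HasDerivAt (fun r : ℝ => c s + (r - s) • v) v s := by
    simpa using (((hasDerivAt_id s).sub_const s).smul_const v).const_add (c s)
  exact this.congr_of_eventuallyEq h

theorem length_lt_top (γ : CPWLPath d) : γ.length < ∞ := by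
  obtain ⟨B, hB, T, hT, h⟩ := γ.exists_finite_locally_affine
  obtain ⟨M, hM⟩ := (hT.image (fun v => ‖v‖₊)).bddAbove
  have hae : ∀ᵐ s ∂volume.restrict (Icc γ.a γ.b), ‖deriv γ.toFun s‖ₑ ≤ (M : ℝ≥0∞) := by
    rw [ae_restrict_iff' measurableSet_Icc]
    filter_upwards [hB.countable.ae_notMem volume] with s hs hmem
    obtain ⟨v, hv, hloc⟩ := h s ⟨hmem, hs⟩
    rw [(hasDerivAt_of_locally_affine hloc).deriv, enorm_eq_nnnorm, ENNReal.coe_le_coe]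
    exact hM (mem_image_of_mem _ hv)
  calc γ.length ≤ ∫⁻ _ in Icc γ.a γ.b, (M : ℝ≥0∞) := lintegral_mono_ae hae
    _ < ∞ := by
      rw [setLIntegral_const, Real.volume_Icc]
      exact ENNReal.mul_lt_top ENNReal.coe_lt_top ENNReal.ofReal_lt_top

/-- The velocity vanishes almost everywhere, and the fundamental theorem of calculus tolerates the
finitely many breakpoints. -/
theorem eq_of_length_eq_zero (γ : CPWLPath d) (h0 : γ.length = 0) {s : ℝ}
    (hs : s ∈ Icc γ.a γ.b) : γ.toFun s = γ.toFun γ.a := by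
  obtain ⟨B, hB, T, hT, h⟩ := γ.exists_finite_locally_affine
  have hae : ∀ᵐ r ∂volume.restrict (Icc γ.a γ.b), deriv γ.toFun r = 0 := by
    have hm : Measurable fun t => ‖deriv γ.toFun t‖ₑ := (measurable_deriv γ.toFun).enorm
    filter_upwards [(lintegral_eq_zero_iff hm).1 h0] with r hr using by simpa using hr
  have hae' : deriv γ.toFun =ᵐ[volume.restrict (uIoc γ.a s)] 0 := by
    refine ae_mono (Measure.restrict_mono ?_ le_rfl) hae
    rw [uIoc_of_le hs.1]
    exact Ioc_subset_Icc_self.trans (Icc_subset_Icc_right hs.2)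
  have hint : IntervalIntegrable (deriv γ.toFun) volume γ.a s := by
    rw [intervalIntegrable_iff]
    exact (integrable_zero _ _ _).congr hae'.symm
  have hftc := integral_eq_of_hasDerivAt_off_countable γ.toFun (deriv γ.toFun) hB.countable
    (a := γ.a) (b := s) (by
      rw [uIcc_of_le hs.1]
      exact γ.continuousOn.mono (Icc_subset_Icc_right hs.2))
    (fun x hx => by
      rw [min_eq_left hs.1, max_eq_right hs.1] at hx
      obtain ⟨v, _, hloc⟩ := h x ⟨⟨hx.1.1.le, hx.1.2.le.trans hs.2⟩, hx.2⟩
      exact (hasDerivAt_of_locally_affine hloc).differentiableAt.hasDerivAt) hint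
  rw [intervalIntegral.integral_congr_ae_restrict hae'] at hftc
  simpa [sub_eq_zero, eq_comm] using hftc

theorem extend_eq_of_length_eq_zero (γ : CPWLPath d) (h0 : γ.length = 0) (s : ℝ) :
    γ.extend s = γ.toFun γ.a :=
  γ.eq_of_length_eq_zero h0 (projIcc γ.a γ.b γ.lt.le s).2

/-- The velocity of the image of a path is a directional derivative, off finitely many parameters
that do not depend on the map. -/
theorem exists_finite_deriv_comp (γ : CPWLPath d) :
    ∃ B : Set ℝ, B.Finite ∧ ∀ s ∈ Icc γ.a γ.b \ B, ∀ {V : Type} [NormedAddCommGroup V]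
      [NormedSpace ℝ V] (F : EuclideanSpace ℝ (Fin d) → V),
      deriv (F ∘ γ.toFun) s = lineDeriv ℝ F (γ.toFun s) (deriv γ.toFun s) := by
  obtain ⟨B, hB, T, hT, h⟩ := γ.exists_finite_locally_affine
  refine ⟨B, hB, fun s hs V _ _ F => ?_⟩
  obtain ⟨v, -, hloc⟩ := h s hs
  rw [(hasDerivAt_of_locally_affine hloc).deriv, lineDeriv]
  have h1 : F ∘ γ.toFun =ᶠ[𝓝 s] fun r => (fun τ : ℝ => F (γ.toFun s + τ • v)) (r - s) := by
    filter_upwards [hloc] with r hr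
    simp [hr]
  rw [h1.deriv_eq, deriv_comp_sub_const (f := fun τ : ℝ => F (γ.toFun s + τ • v)), sub_self]

end CPWLPath

/-! ### Knots as unstable parameters -/

section Knots

variable {d : ℕ} {V : Type*} [NormedAddCommGroup V] [NormedSpace ℝ V]

theorem continuousWithinAt_indicator_iff {X : Type*} {R : Set X} {c : ℝ → X} {S : Set ℝ} {t : ℝ}
    : ContinuousWithinAt (fun s => R.indicator (fun _ => (1 : ℝ)) (c s)) S t ↔
      ∀ᶠ s in 𝓝[S] t, (c s ∈ R ↔ c t ∈ R) := by
  classical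
  constructor
  · intro h
    have h1 := h.eventually (Metric.ball_mem_nhds _ (show (0 : ℝ) < 1 / 2 by norm_num))
    filter_upwards [h1] with s hs
    by_cases h1 : c s ∈ R <;> by_cases h2 : c t ∈ R <;>
      simp [indicator, h1, h2] at hs ⊢ <;> linarith [hs]
  · intro h
    refine (continuousWithinAt_const (b := R.indicator (fun _ => (1 : ℝ)) (c t))).congr_of_eventuallyEq
      ?_ rfl
    filter_upwards [h] with s hs
    simp [indicator, hs]

/-- The knots of a continuous selection of affine maps along a path are the parameters at which it
fails to be locally invariant under the translations along the path. -/
theorem knotsAlong_eq {f : EuclideanSpace ℝ (Fin d) → V} (hf : IsAffineSelection f)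
    (γ : CPWLPath d) : knotsAlong f γ = {t | ¬ IsStableAt f γ.extend t} := by
  have hreg : ∀ t ∈ Icc γ.a γ.b, ∀ R : Set (EuclideanSpace ℝ (Fin d)),
      (∀ᶠ s in 𝓝[Icc γ.a γ.b] t, (γ.toFun s ∈ R ↔ γ.toFun t ∈ R)) ↔
        ∀ᶠ s in 𝓝 t, (γ.extend s ∈ R ↔ γ.extend t ∈ R) := by
    intro t ht R
    constructor
    · intro h
      -- Clamping to [a, b] turns neighbourhoods relative to the segment into full ones, endpoints
      -- included.
      have hlim : Tendsto (fun s => (projIcc γ.a γ.b γ.lt.le s : ℝ)) (𝓝 t) (𝓝[Icc γ.a γ.b] t) := by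
        refine tendsto_nhdsWithin_iff.2 ⟨?_, Eventually.of_forall fun s => Subtype.prop _⟩
        have := (continuous_subtype_val.comp (continuous_projIcc (h := γ.lt.le))).tendsto t
        rwa [Function.comp_apply, projIcc_of_mem _ ht] at this
      filter_upwards [hlim.eventually h] with s hs
      rw [γ.extend_of_mem ht]
      exact hs
    · intro h
      filter_upwards [h.filter_mono nhdsWithin_le_nhds, self_mem_nhdsWithin] with s hs hmem
      rwa [γ.extend_of_mem hmem, γ.extend_of_mem ht] at hs
  ext t
  rw [knotsAlong]
  change t ∈ Icc γ.a γ.b ∧ ¬ ContinuousWithinAt (characteristicAlong f γ) (Icc γ.a γ.b) t ↔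
    ¬ IsStableAt f γ.extend t
  rw [isStableAt_iff_regions hf γ.continuous_extend γ.germAffine_extend]
  by_cases ht : t ∈ Icc γ.a γ.b
  · rw [and_iff_right ht, not_iff_not, continuousWithinAt_pi]
    constructor
    · intro h g
      by_cases hne : (interior {x | f x = g x}).Nonempty
      · exact (hreg t ht _).1
          ((continuousWithinAt_indicator_iff).1 (h ⟨pieceRegion f g, g, hne, rfl⟩))
      -- An affine map that is not a piece of f has an empty region, so its condition is vacuous.
      · rw [not_nonempty_iff_eq_empty] at hne
        simp [pieceRegion, hne]
    · rintro h ⟨R, g, hne, rfl⟩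
      exact (continuousWithinAt_indicator_iff).2 ((hreg t ht _).2 (h g))
  · refine iff_of_false (fun h => ht h.1) (not_not.2 fun g => ?_)
    filter_upwards [γ.extend_eventuallyEq ht] with s hs
    rw [hs]

theorem knotsAlong_eq_empty_of_length_eq_zero {f : EuclideanSpace ℝ (Fin d) → V}
    (hf : IsAffineSelection f) {γ : CPWLPath d} (h0 : γ.length = 0) : knotsAlong f γ = ∅ := by
  rw [knotsAlong_eq hf]
  refine eq_empty_of_forall_notMem fun t ht => ht (Eventually.of_forall fun q => ?_)
  simp [γ.extend_eq_of_length_eq_zero h0]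

/-- The division can be undone: the length is finite, and a path of length zero has no knots. -/
theorem encard_knotsAlong_eq_mul {f : EuclideanSpace ℝ (Fin d) → V} (hf : IsAffineSelection f)
    (γ : CPWLPath d) : ((knotsAlong f γ).encard : ℝ≥0∞) = knotDensity f γ * γ.length := by
  by_cases h0 : γ.length = 0
  · simp [knotsAlong_eq_empty_of_length_eq_zero hf h0, h0]
  · rw [knotDensity, ENNReal.div_mul_cancel h0 γ.length_lt_top.ne]

end Knots

/-! ### Measurability of the number of unstable parameters -/

section Counting

theorem exists_injOn_floor_mul {S : Set ℝ} (hS : S.Finite) :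
    ∃ m : ℕ, InjOn (fun t : ℝ => ⌊((m : ℝ) + 1) * t⌋) S := by
  have h : ∀ᶠ m : ℕ in atTop, ∀ x ∈ S, ∀ y ∈ S,
      ⌊((m : ℝ) + 1) * x⌋ = ⌊((m : ℝ) + 1) * y⌋ → x = y := by
    refine (hS.eventually_all).2 fun x _ => (hS.eventually_all).2 fun y _ => ?_
    by_cases hxy : x = y
    · exact Eventually.of_forall fun _ _ => hxy
    · have hpos : 0 < |x - y| := abs_pos.2 (sub_ne_zero.2 hxy)
      filter_upwards [eventually_ge_atTop ⌈1 / |x - y|⌉₊] with m hm heq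
      have h1 := Int.abs_sub_lt_one_of_floor_eq_floor heq
      have h2 : 1 / |x - y| ≤ (m : ℝ) := (Nat.le_ceil _).trans (by exact_mod_cast hm)
      rw [div_le_iff₀ hpos] at h2
      rw [← mul_sub, abs_mul, abs_of_pos (by positivity : (0 : ℝ) < (m : ℝ) + 1)] at h1
      nlinarith
  obtain ⟨m, hm⟩ := h.exists
  exact ⟨m, fun x hx y hy => hm x hx y hy⟩

/-- A grid of mesh 1/(m + 1) meets B in at most as many cells as B has points, and a fine enough
grid separates any given finite subset of B. -/
theorem encard_eq_iSup_encard_floor (B : Set ℝ) :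
    B.encard = ⨆ m : ℕ, ((fun t : ℝ => ⌊((m : ℝ) + 1) * t⌋) '' B).encard := by
  refine le_antisymm ?_ (iSup_le fun m => encard_image_le _ _)
  refine ENat.forall_natCast_le_iff_le.1 fun n hn => ?_
  obtain ⟨S, hSB, hSn⟩ := exists_subset_encard_eq hn
  have hS : S.Finite := finite_of_encard_eq_coe hSn
  obtain ⟨m, hm⟩ := exists_injOn_floor_mul hS
  calc (n : ℕ∞) = ((fun t : ℝ => ⌊((m : ℝ) + 1) * t⌋) '' S).encard := by
        rw [hm.encard_image, hSn]
    _ ≤ ((fun t : ℝ => ⌊((m : ℝ) + 1) * t⌋) '' B).encard := encard_le_encard (image_mono hSB)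
    _ ≤ _ := le_iSup (fun m : ℕ => ((fun t : ℝ => ⌊((m : ℝ) + 1) * t⌋) '' B).encard) m

/-- A half-open grid cell is a countable union of closed segments, so only hits of compact segments
need to be measurable. -/
theorem mem_image_floor_iff {B : Set ℝ} {m : ℕ} {j : ℤ} :
    j ∈ (fun t : ℝ => ⌊((m : ℝ) + 1) * t⌋) '' B ↔
      ∃ i : ℕ, ∃ t ∈ Icc ((j : ℝ) / (m + 1)) ((j + 1) / (m + 1) - 1 / (i + 1)), t ∈ B := by
  have hm : (0 : ℝ) < (m : ℝ) + 1 := by positivity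
  constructor
  · rintro ⟨t, htB, rfl⟩
    have h1 : t < ((⌊((m : ℝ) + 1) * t⌋ : ℝ) + 1) / (m + 1) := by
      rw [lt_div_iff₀ hm, mul_comm]
      exact Int.lt_floor_add_one _
    obtain ⟨i, hi⟩ := exists_nat_one_div_lt (sub_pos.2 h1)
    refine ⟨i, t, ⟨?_, by linarith⟩, htB⟩
    rw [div_le_iff₀ hm, mul_comm t]
    exact Int.floor_le _
  · rintro ⟨i, t, ⟨h1, h2⟩, htB⟩
    have h3 : t < ((j : ℝ) + 1) / (m + 1) := by
      have : (0 : ℝ) < 1 / ((i : ℝ) + 1) := by positivity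
      linarith
    refine ⟨t, htB, ?_⟩
    rw [div_le_iff₀ hm, mul_comm t] at h1
    rw [lt_div_iff₀ hm, mul_comm t] at h3
    exact Int.floor_eq_iff.2 ⟨h1, h3⟩

/-- The cardinality of a random set of reals is measurable as soon as the events that the set meets
a given segment are. -/
theorem measurable_encard_of_measurableSet_hit {Ω : Type*} [MeasurableSpace Ω] {B : Ω → Set ℝ}
    (hB : ∀ q r : ℝ, MeasurableSet {ω | ∃ t ∈ Icc q r, t ∈ B ω}) :
    Measurable fun ω => ((B ω).encard : ℝ≥0∞) := by
  classical
  simp_rw [encard_eq_iSup_encard_floor, ENat.toENNReal_iSup]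
  refine Measurable.iSup fun m => ?_
  simp_rw [← ENNReal.tsum_set_one, tsum_subtype _ (fun _ => (1 : ℝ≥0∞))]
  refine Measurable.tsum fun j => ?_
  simp only [indicator]
  refine Measurable.ite ?_ measurable_const measurable_const
  simp_rw [mem_image_floor_iff]
  rw [ofPred_exists]
  exact MeasurableSet.iUnion fun i => hB ((j : ℝ) / (m + 1)) ((j + 1) / (m + 1) - 1 / (i + 1))

variable {E V : Type*} [NormedAddCommGroup E] [NormedAddCommGroup V]

/-- On a compact segment stability is uniform, with one radius 1/(n + 1) for all parameters. The
resulting equation is closed in (parameter, shift, displacement), so a dense sequence tests it;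
`projIcc` lets the parameter range over all of ℝ. -/
theorem forall_Icc_isStableAt_iff [SecondCountableTopology E] {f : E → V} {c : ℝ → E}
    (hf : Continuous f) (hc : Continuous c) {q r : ℝ} (hqr : q ≤ r) :
    (∀ t ∈ Icc q r, IsStableAt f c t) ↔
      ∃ n : ℕ, ∀ k : ℕ, ∀ p : ℝ × ℝ × E, p = TopologicalSpace.denseSeq (ℝ × ℝ × E) k →
        |p.2.1| < 1 / ((n : ℝ) + 1) → ‖p.2.2‖ < 1 / ((n : ℝ) + 1) →
        f (c (projIcc q r hqr p.1 + p.2.1) + p.2.2) - f (c (projIcc q r hqr p.1 + p.2.1)) =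
          f (c (projIcc q r hqr p.1) + p.2.2) - f (c (projIcc q r hqr p.1)) := by
  constructor
  · intro h
    -- Two parameters near t are compared with each other by comparing each with t.
    have hloc : ∀ t ∈ Icc q r, ∀ᶠ z : (ℝ × E) × ℝ in 𝓝 ((0, 0), t),
        f (c (z.2 + z.1.1) + z.1.2) - f (c (z.2 + z.1.1)) = f (c z.2 + z.1.2) - f (c z.2) := by
      intro t ht
      have l1 : Tendsto (fun z : (ℝ × E) × ℝ => (z.2 + z.1.1, z.1.2)) (𝓝 ((0, 0), t))
          (𝓝 (t, 0)) := by
        have : Continuous fun z : (ℝ × E) × ℝ => (z.2 + z.1.1, z.1.2) := by fun_prop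
        simpa using this.tendsto ((0, 0), t)
      have l2 : Tendsto (fun z : (ℝ × E) × ℝ => (z.2, z.1.2)) (𝓝 ((0, 0), t)) (𝓝 (t, 0)) := by
        have : Continuous fun z : (ℝ × E) × ℝ => (z.2, z.1.2) := by fun_prop
        simpa using this.tendsto ((0, 0), t)
      filter_upwards [l1.eventually (h t ht), l2.eventually (h t ht)] with z h1 h2
      exact h1.trans h2.symm
    have hunif := (isCompact_Icc (a := q) (b := r)).eventually_forall_of_forall_eventually
      (P := fun (z : ℝ × E) s => f (c (s + z.1) + z.2) - f (c (s + z.1)) = f (c s + z.2) - f (c s))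
      hloc
    obtain ⟨ε, hε, hball⟩ := Metric.eventually_nhds_iff_ball.1 hunif
    obtain ⟨n, hn⟩ := exists_nat_one_div_lt hε
    refine ⟨n, fun k p _ h1 h2 => hball (p.2.1, p.2.2) ?_ _ (projIcc q r hqr p.1).2⟩
    rw [Metric.mem_ball, Prod.dist_eq, max_lt_iff, dist_zero_right, dist_zero_right]
    exact ⟨h1.trans hn, h2.trans hn⟩
  · rintro ⟨n, hn⟩ t ht
    have hpc : Continuous fun p : ℝ × ℝ × E => (projIcc q r hqr p.1 : ℝ) :=
      continuous_subtype_val.comp (continuous_projIcc.comp continuous_fst)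
    have hclosed : IsClosed {p : ℝ × ℝ × E | 1 / ((n : ℝ) + 1) ≤ |p.2.1| ∨
        1 / ((n : ℝ) + 1) ≤ ‖p.2.2‖ ∨
        f (c (projIcc q r hqr p.1 + p.2.1) + p.2.2) - f (c (projIcc q r hqr p.1 + p.2.1)) =
          f (c (projIcc q r hqr p.1) + p.2.2) - f (c (projIcc q r hqr p.1))} := by
      refine (isClosed_le continuous_const (g := fun p : ℝ × ℝ × E => |p.2.1|) (by fun_prop)).union
        ((isClosed_le continuous_const (g := fun p : ℝ × ℝ × E => ‖p.2.2‖) (by fun_prop)).union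
          (isClosed_eq ?_ ?_)) <;> fun_prop
    have hall := fun p : ℝ × ℝ × E => (TopologicalSpace.denseRange_denseSeq (ℝ × ℝ × E)).induction_on
      (p := fun p : ℝ × ℝ × E => 1 / ((n : ℝ) + 1) ≤ |p.2.1| ∨ 1 / ((n : ℝ) + 1) ≤ ‖p.2.2‖ ∨
        f (c (projIcc q r hqr p.1 + p.2.1) + p.2.2) - f (c (projIcc q r hqr p.1 + p.2.1)) =
          f (c (projIcc q r hqr p.1) + p.2.2) - f (c (projIcc q r hqr p.1))) p hclosed
      (fun k => by
        have := hn k _ rfl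
        by_contra hcon
        push Not at hcon
        exact hcon.2.2 (this hcon.1 hcon.2.1))
    have hpos : (0 : ℝ) < 1 / ((n : ℝ) + 1) := by positivity
    have e1 : ∀ᶠ s in 𝓝 t, |s - t| < 1 / ((n : ℝ) + 1) := by
      filter_upwards [Metric.ball_mem_nhds t hpos] with s hs using by
        simpa [Real.dist_eq] using hs
    have e2 : ∀ᶠ v in 𝓝 (0 : E), ‖v‖ < 1 / ((n : ℝ) + 1) := by
      filter_upwards [Metric.ball_mem_nhds (0 : E) hpos] with v hv using by simpa using hv
    rw [IsStableAt, nhds_prod_eq]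
    filter_upwards [e1.prod_mk e2] with z hz
    have := hall (t, z.1 - t, z.2)
    simp only [projIcc_of_mem _ ht, add_sub_cancel] at this
    rcases this with h | h | h
    · exact absurd hz.1 (not_lt.2 h)
    · exact absurd hz.2 (not_lt.2 h)
    · exact h

variable {Ω : Type*} [MeasurableSpace Ω] [MeasurableSpace E] [BorelSpace E]
  [SecondCountableTopology E] [MeasurableSpace V] [BorelSpace V] [SecondCountableTopology V]

omit [SecondCountableTopology V] in
theorem Measurable.apply_of_continuous {f : Ω → E → V} (hf : ∀ ω, Continuous (f ω))
    (hfm : ∀ x, Measurable fun ω => f ω x) {Y : Type*} [MeasurableSpace Y] {a : Y → Ω} {b : Y → E}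
    (ha : Measurable a) (hb : Measurable b) : Measurable fun y => f (a y) (b y) :=
  (measurable_uncurry_of_continuous_of_measurable (u := fun x ω => f ω x) hf hfm).comp
    (hb.prodMk ha)

/-- The number of parameters at which a random continuous function is unstable along a random
continuous curve is measurable. -/
theorem measurable_encard_not_isStableAt {f : Ω → E → V} {c : Ω → ℝ → E}
    (hf : ∀ ω, Continuous (f ω)) (hfm : ∀ x, Measurable fun ω => f ω x)
    (hc : ∀ ω, Continuous (c ω)) (hcm : ∀ s, Measurable fun ω => c ω s) :
    Measurable fun ω => ({t | ¬ IsStableAt (f ω) (c ω) t}.encard : ℝ≥0∞) := by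
  refine measurable_encard_of_measurableSet_hit fun q r => ?_
  rcases le_or_gt q r with hqr | hqr
  · have : {ω | ∃ t ∈ Icc q r, t ∈ {t | ¬ IsStableAt (f ω) (c ω) t}} =
        {ω | ∀ t ∈ Icc q r, IsStableAt (f ω) (c ω) t}ᶜ := by
      ext ω
      change (∃ t ∈ Icc q r, ¬ IsStableAt (f ω) (c ω) t) ↔ ¬ ∀ t ∈ Icc q r, IsStableAt (f ω) (c ω) t
      push Not
      rfl
    rw [this]
    refine MeasurableSet.compl ?_
    simp_rw [fun ω => forall_Icc_isStableAt_iff (hf ω) (hc ω) hqr, ofPred_exists, ofPred_forall]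
    refine MeasurableSet.iUnion fun n => MeasurableSet.iInter fun k => ?_
    have hpt : ∀ s v, Measurable fun ω => f ω (c ω s + v) := fun s v =>
      Measurable.apply_of_continuous hf hfm measurable_id ((hcm s).add_const v)
    have hpt' : ∀ s, Measurable fun ω => f ω (c ω s) := fun s =>
      Measurable.apply_of_continuous hf hfm measurable_id (hcm s)
    set p := TopologicalSpace.denseSeq (ℝ × ℝ × E) k
    rw [iInter_iInter_eq_left]
    refine MeasurableSet.iInter fun _ => MeasurableSet.iInter fun _ => ?_
    exact measurableSet_eq_fun ((hpt _ _).sub (hpt' _)) ((hpt _ _).sub (hpt' _))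
  · simp [Icc_eq_empty (not_le.2 hqr)]

end Counting

/-! ### Joint measurability of velocities -/

section Derivative

variable {V : Type*} [NormedAddCommGroup V] [NormedSpace ℝ V]

theorem HasDerivAt.eq_smul_of_slope {c : ℝ → V} {s u : ℝ} {v p : V} (h : HasDerivAt c v s)
    (hp : ∀ᶠ τ in 𝓝[>] (0 : ℝ), c (s + τ * u) = c s + τ • p) : p = u • v := by
  have h1 : HasDerivAt (fun τ : ℝ => c (s + τ * u)) (u • v) 0 := by
    have h2 : HasDerivAt (fun τ : ℝ => s + τ * u) u 0 := by
      simpa using ((hasDerivAt_id (0 : ℝ)).mul_const u).const_add s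
    exact HasDerivAt.scomp (0 : ℝ) (by simpa using h) h2
  have h3 : HasDerivAt (fun τ : ℝ => c s + τ • p) p 0 := by
    simpa using ((hasDerivAt_id (0 : ℝ)).smul_const p).const_add (c s)
  have h4 : HasDerivWithinAt (fun τ : ℝ => c (s + τ * u)) p (Ioi 0) 0 :=
    h3.hasDerivWithinAt.congr_of_eventuallyEq hp (by simp)
  exact (uniqueDiffWithinAt_Ioi 0).eq_deriv _ h4 h1.hasDerivWithinAt

/-- Differentiability means that the two one-sided slopes are opposite, the left one being taken in
direction -1; otherwise `deriv` has its default value 0. -/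
theorem deriv_eq_ite_of_slopes [DecidableEq V] {c : ℝ → V} {s : ℝ} {p q : V}
    (hp : ∀ᶠ τ in 𝓝[>] (0 : ℝ), c (s + τ * 1) = c s + τ • p)
    (hq : ∀ᶠ τ in 𝓝[>] (0 : ℝ), c (s + τ * (-1)) = c s + τ • q) :
    deriv c s = if p = -q then p else 0 := by
  split_ifs with h
  · refine (CPWLPath.hasDerivAt_of_locally_affine ?_).deriv
    refine eventually_nhds_of_rays (by simp) ?_ ?_
    · filter_upwards [hp] with τ hτ
      rw [hτ]
      simp
    · filter_upwards [hq] with τ hτ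
      rw [hτ, h]
      simp
  · refine deriv_zero_of_not_differentiableAt fun hd => h ?_
    rw [hd.hasDerivAt.eq_smul_of_slope hp, hd.hasDerivAt.eq_smul_of_slope hq]
    simp

variable {Ω : Type*} [MeasurableSpace Ω] [MeasurableSpace V] [BorelSpace V]
  [SecondCountableTopology V]

/-- The derivative of a random one-sided affine curve is jointly measurable. -/
theorem measurable_deriv_of_germAffine {c : Ω → ℝ → V} (hc : ∀ ω, Continuous (c ω))
    (hcm : ∀ s, Measurable fun ω => c ω s) (hg : ∀ ω, GermAffine (c ω)) :
    Measurable fun p : Ω × ℝ => deriv (c p.1) p.2 := by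
  classical
  choose slope hslope using hg
  have hmeas : ∀ u, Measurable fun p : Ω × ℝ => slope p.1 p.2 u := by
    intro u
    -- The slope is the eventually constant limit of the difference quotients with step 1/(n + 1).
    refine measurable_of_tendsto_metrizable (f := fun (n : ℕ) (p : Ω × ℝ) =>
      ((n : ℝ) + 1) • (c p.1 (p.2 + 1 / ((n : ℝ) + 1) * u) - c p.1 p.2)) (fun n => ?_) ?_
    · refine Measurable.const_smul (Measurable.sub ?_ ?_) _
      · exact Measurable.apply_of_continuous hc hcm measurable_fst (by fun_prop)
      · exact Measurable.apply_of_continuous hc hcm measurable_fst measurable_snd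
    · rw [tendsto_pi_nhds]
      intro p
      refine tendsto_const_nhds.congr' ?_
      have hlim : Tendsto (fun n : ℕ => 1 / ((n : ℝ) + 1)) atTop (𝓝[>] 0) :=
        tendsto_nhdsWithin_iff.2 ⟨tendsto_one_div_add_atTop_nhds_zero_nat,
          Eventually.of_forall fun n => by simpa using (by positivity : (0 : ℝ) < (n : ℝ) + 1)⟩
      filter_upwards [hlim.eventually (hslope p.1 p.2 u)] with n hn
      rw [hn, add_sub_cancel_left, smul_smul, mul_one_div_cancel (by positivity), one_smul]
  simp_rw [fun p : Ω × ℝ => deriv_eq_ite_of_slopes (hslope p.1 p.2 1) (hslope p.1 p.2 (-1))]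
  exact Measurable.ite (measurableSet_eq_fun (hmeas 1) (hmeas (-1)).neg) (hmeas 1) measurable_const

end Derivative

/-! ### Length and velocity of the extended path -/

namespace CPWLPath

variable {d : ℕ}

theorem extend_eventuallyEq_toFun (γ : CPWLPath d) {s : ℝ} (hs : s ∈ Ioo γ.a γ.b) :
    γ.extend =ᶠ[𝓝 s] γ.toFun := by
  filter_upwards [Ioo_mem_nhds hs.1 hs.2] with r hr
  exact γ.extend_of_mem (Ioo_subset_Icc_self hr)

theorem length_eq_lintegral_extend (γ : CPWLPath d) :
    γ.length = ∫⁻ t in Icc γ.a γ.b, ‖deriv γ.extend t‖ₑ := by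
  rw [length, ← setLIntegral_congr (Ioo_ae_eq_Icc (μ := volume)),
    ← setLIntegral_congr (Ioo_ae_eq_Icc (μ := volume))]
  refine setLIntegral_congr_fun measurableSet_Ioo fun s hs => ?_
  rw [(γ.extend_eventuallyEq_toFun hs).deriv_eq]

/-- The exceptional null set is fixed before F, so that one set serves all realizations of a random
F. -/
theorem ae_deriv_comp_extend (γ : CPWLPath d) :
    ∀ᵐ s ∂volume.restrict (Icc γ.a γ.b), ∀ {n : ℕ}
      (F : EuclideanSpace ℝ (Fin d) → EuclideanSpace ℝ (Fin n)),
      deriv (F ∘ γ.extend) s = lineDeriv ℝ F (γ.extend s) (deriv γ.extend s) := by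
  obtain ⟨B, hB, h⟩ := γ.exists_finite_deriv_comp
  rw [Measure.restrict_congr_set (Ioo_ae_eq_Icc (μ := volume)).symm, ae_restrict_iff' measurableSet_Ioo]
  filter_upwards [hB.countable.ae_notMem volume] with s hsB hs n F
  have he := γ.extend_eventuallyEq_toFun hs
  rw [he.deriv_eq, he.eq_of_nhds, ← h s ⟨Ioo_subset_Icc_self hs, hsB⟩ F]
  exact (he.fun_comp F).deriv_eq

end CPWLPath

/-! ### Stability and measurability of compositions -/

section Networks

variable {L : ℕ} {d : Fin (L + 1) → ℕ}

theorem partialComposition_succ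
    (g : ∀ l : Fin L, EuclideanSpace ℝ (Fin (d l.castSucc)) → EuclideanSpace ℝ (Fin (d l.succ)))
    (l : Fin L) : partialComposition g l.succ = g l ∘ partialComposition g l.castSucc := rfl

/-- This makes the input path of a layer insensitive to resampling that layer's parameter. -/
theorem partialComposition_congr
    {g g' : ∀ l : Fin L, EuclideanSpace ℝ (Fin (d l.castSucc)) → EuclideanSpace ℝ (Fin (d l.succ))}
    (m : Fin (L + 1)) (h : ∀ l : Fin L, l.castSucc < m → g l = g' l) :
    partialComposition g m = partialComposition g' m := by
  induction m using Fin.induction with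
  | zero => rfl
  | succ l ih =>
    rw [partialComposition_succ, partialComposition_succ, h l (Fin.castSucc_lt_succ),
      ih fun i hi => h i (hi.trans Fin.castSucc_lt_succ)]

theorem isAffineSelection_partialComposition
    {g : ∀ l : Fin L, EuclideanSpace ℝ (Fin (d l.castSucc)) → EuclideanSpace ℝ (Fin (d l.succ))}
    (hg : ∀ l, IsAffineSelection (g l)) (m : Fin (L + 1)) :
    IsAffineSelection (partialComposition g m) := by
  induction m using Fin.induction with
  | zero => exact isAffineSelection_id
  | succ l ih => exact (hg l).comp ih

theorem isStableAt_partialComposition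
    {g : ∀ l : Fin L, EuclideanSpace ℝ (Fin (d l.castSucc)) → EuclideanSpace ℝ (Fin (d l.succ))}
    (hg : ∀ l, IsAffineSelection (g l)) {c : ℝ → EuclideanSpace ℝ (Fin (d 0))} {t : ℝ}
    (h : ∀ (l : Fin L) (k : Fin (d l.succ)),
      IsStableAt (fun x => g l x k) (partialComposition g l.castSucc ∘ c) t) (m : Fin (L + 1)) :
    IsStableAt (partialComposition g m) c t := by
  induction m using Fin.induction with
  | zero => exact isStableAt_id c t
  | succ l ih =>
    exact IsStableAt.comp (f := g l) (h := partialComposition g l.castSucc)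
      (isAffineSelection_partialComposition hg _).1 ih
      (isStableAt_of_forall_apply (h l))

theorem encard_iUnion_le_sum {ι α : Type*} [Fintype ι] (S : ι → Set α) :
    ((⋃ i, S i).encard : ℝ≥0∞) ≤ ∑ i, ((S i).encard : ℝ≥0∞) := by
  simp_rw [← ENNReal.tsum_set_one]
  exact ENNReal.tsum_iUnion_le (fun _ => 1) S

/-- The unstable parameters of a composition come from the components of its layers. -/
theorem encard_not_isStableAt_partialComposition_le
    {g : ∀ l : Fin L, EuclideanSpace ℝ (Fin (d l.castSucc)) → EuclideanSpace ℝ (Fin (d l.succ))}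
    (hg : ∀ l, IsAffineSelection (g l)) (c : ℝ → EuclideanSpace ℝ (Fin (d 0))) (m : Fin (L + 1)) :
    ({t | ¬ IsStableAt (partialComposition g m) c t}.encard : ℝ≥0∞) ≤
      ∑ l : Fin L, ∑ k : Fin (d l.succ),
        ({t | ¬ IsStableAt (fun x => g l x k) (partialComposition g l.castSucc ∘ c) t}.encard :
          ℝ≥0∞) := by
  have hsub : {t | ¬ IsStableAt (partialComposition g m) c t} ⊆ ⋃ l : Fin L, ⋃ k : Fin (d l.succ),
      {t | ¬ IsStableAt (fun x => g l x k) (partialComposition g l.castSucc ∘ c) t} := by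
    intro t ht
    by_contra hcon
    simp only [mem_iUnion, not_exists] at hcon
    exact ht (isStableAt_partialComposition hg (fun l k => not_not.1 (hcon l k)) m)
  refine (ENat.toENNReal_le.2 (encard_le_encard hsub)).trans ?_
  exact (encard_iUnion_le_sum _).trans (Finset.sum_le_sum fun l _ => encard_iUnion_le_sum _)

variable {Z : Type*} [MeasurableSpace Z]

theorem measurable_partialComposition
    {g : Z → ∀ l : Fin L,
      EuclideanSpace ℝ (Fin (d l.castSucc)) → EuclideanSpace ℝ (Fin (d l.succ))}
    (hg : ∀ z l, Continuous (g z l)) (hgm : ∀ l x, Measurable fun z => g z l x) (m : Fin (L + 1))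
    (x : EuclideanSpace ℝ (Fin (d 0))) : Measurable fun z => partialComposition (g z) m x := by
  induction m using Fin.induction with
  | zero => exact measurable_const
  | succ l ih =>
    exact Measurable.apply_of_continuous (fun z => hg z l) (hgm l) measurable_id ih

end Networks

/-! ### Expected lengths and knot counts -/

section Expectation

/-- Resampling one coordinate does not change an integral against a product of probability
measures. -/
theorem lintegral_pi_eq_lintegral_update {ι : Type*} [Fintype ι] [DecidableEq ι] {X : ι → Type*}
    [∀ i, MeasurableSpace (X i)] (μ : ∀ i, Measure (X i)) [∀ i, IsProbabilityMeasure (μ i)] (i : ι)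
    {h : (∀ i, X i) → ℝ≥0∞} (hh : Measurable h) :
    ∫⁻ z, h z ∂Measure.pi μ = ∫⁻ z, ∫⁻ x, h (Function.update z i x) ∂μ i ∂Measure.pi μ := by
  have hne : Nonempty (∀ i, X i) := ⟨fun j => (nonempty_of_isProbabilityMeasure (μ j)).some⟩
  have hm : Measurable fun z => ∫⁻ x, h (Function.update z i x) ∂μ i := by
    have := hh.lmarginal μ (s := {i})
    rwa [lmarginal_singleton] at this
  -- Coordinate i is integrated out first on both sides; on the right the integrand no longer
  -- depends on it, and the total mass is 1.
  rw [lintegral_eq_lmarginal_univ hne.some, lintegral_eq_lmarginal_univ hne.some,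
    lmarginal_erase' h hh (Finset.mem_univ i), lmarginal_erase' _ hm (Finset.mem_univ i)]
  simp

variable {d n : ℕ} {Z : Type*} [MeasurableSpace Z]

theorem measurable_lineDeriv_of_isAffineSelection
    {F : Z → EuclideanSpace ℝ (Fin d) → EuclideanSpace ℝ (Fin n)}
    (hF : ∀ z, IsAffineSelection (F z)) (hFm : ∀ x, Measurable fun z => F z x)
    (x u : EuclideanSpace ℝ (Fin d)) : Measurable fun z => lineDeriv ℝ (F z) x u := by
  have hline : GermAffine fun τ : ℝ => x + τ • u := fun s r =>
    ⟨r • u, Eventually.of_forall fun τ => by simp only [add_smul, mul_smul]; abel⟩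
  have := measurable_deriv_of_germAffine (c := fun z τ => F z (x + τ • u))
    (fun z => (hF z).1.comp (by fun_prop)) (fun _ => hFm _) (fun z => (hF z).germAffine_comp hline)
  exact this.comp (measurable_id.prodMk measurable_const)

theorem measurable_enorm_deriv_comp_extend {F : Z → EuclideanSpace ℝ (Fin d) → EuclideanSpace ℝ (Fin n)}
    (hF : ∀ z, IsAffineSelection (F z)) (hFm : ∀ x, Measurable fun z => F z x)
    (γ : CPWLPath d) :
    Measurable fun p : Z × ℝ => ‖deriv (F p.1 ∘ γ.extend) p.2‖ₑ :=
  (measurable_deriv_of_germAffine (c := fun z => F z ∘ γ.extend)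
    (fun z => (hF z).1.comp γ.continuous_extend) (fun _ => hFm _)
    (fun z => (hF z).germAffine_comp γ.germAffine_extend)).enorm

/-- If the expected norms of the directional derivatives of a random map are bounded by `D`, then
the expected length of the image of a path is at most `D` times that of the path. -/
theorem lintegral_length_map_le (μ : Measure Z) [SFinite μ]
    {F : Z → EuclideanSpace ℝ (Fin d) → EuclideanSpace ℝ (Fin n)}
    (hF : ∀ z, IsAffineSelection (F z)) (hFm : ∀ x, Measurable fun z => F z x) {D : ℝ≥0∞}
    (hD : ∀ x u : EuclideanSpace ℝ (Fin d), ‖u‖ = 1 → ∫⁻ z, ‖lineDeriv ℝ (F z) x u‖ₑ ∂μ ≤ D)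
    (γ : CPWLPath d) : ∫⁻ z, (γ.map (hF z)).length ∂μ ≤ D * γ.length := by
  -- The bound for unit directions extends by homogeneity to arbitrary velocities, zero included.
  have hbound : ∀ x v : EuclideanSpace ℝ (Fin d), ∫⁻ z, ‖lineDeriv ℝ (F z) x v‖ₑ ∂μ ≤ D * ‖v‖ₑ := by
    intro x v
    rcases eq_or_ne v 0 with rfl | hv
    · simp [lineDeriv_zero]
    have hv' : ‖v‖ ≠ 0 := norm_ne_zero_iff.2 hv
    have hu : ‖‖v‖⁻¹ • v‖ = 1 := by rw [norm_smul, norm_inv, norm_norm, inv_mul_cancel₀ hv']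
    have hvu : v = ‖v‖ • (‖v‖⁻¹ • v) := by rw [smul_smul, mul_inv_cancel₀ hv', one_smul]
    calc ∫⁻ z, ‖lineDeriv ℝ (F z) x v‖ₑ ∂μ
        = ∫⁻ z, ‖v‖ₑ * ‖lineDeriv ℝ (F z) x (‖v‖⁻¹ • v)‖ₑ ∂μ := by
          refine lintegral_congr fun z => ?_
          conv_lhs => rw [hvu]
          rw [lineDeriv_smul, enorm_smul, enorm_norm]
      _ = ‖v‖ₑ * ∫⁻ z, ‖lineDeriv ℝ (F z) x (‖v‖⁻¹ • v)‖ₑ ∂μ :=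
          lintegral_const_mul _ (measurable_lineDeriv_of_isAffineSelection hF hFm _ _).enorm
      _ ≤ D * ‖v‖ₑ := by
          rw [mul_comm]
          gcongr
          exact hD _ _ hu
  calc ∫⁻ z, (γ.map (hF z)).length ∂μ
      = ∫⁻ z, (∫⁻ s in Icc γ.a γ.b, ‖deriv (F z ∘ γ.extend) s‖ₑ) ∂μ :=
        lintegral_congr fun z => (γ.map (hF z)).length_eq_lintegral_extend
    _ = ∫⁻ s in Icc γ.a γ.b, ∫⁻ z, ‖deriv (F z ∘ γ.extend) s‖ₑ ∂μ :=
        lintegral_lintegral_swap (measurable_enorm_deriv_comp_extend hF hFm γ).aemeasurable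
    _ ≤ ∫⁻ s in Icc γ.a γ.b, D * ‖deriv γ.extend s‖ₑ := by
        refine lintegral_mono_ae ?_
        filter_upwards [γ.ae_deriv_comp_extend] with s hs
        simp_rw [hs]
        exact hbound _ _
    _ = D * γ.length := by
        rw [lintegral_const_mul _ (measurable_deriv _).enorm, γ.length_eq_lintegral_extend]

theorem measurable_knotDensity {V : Type*} [NormedAddCommGroup V] [NormedSpace ℝ V]
    [MeasurableSpace V] [BorelSpace V] [SecondCountableTopology V]
    {F : Z → EuclideanSpace ℝ (Fin d) → V} (hF : ∀ z, IsAffineSelection (F z))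
    (hFm : ∀ x, Measurable fun z => F z x) (γ : CPWLPath d) :
    Measurable fun z => knotDensity (F z) γ := by
  unfold knotDensity
  simp_rw [fun z => knotsAlong_eq (hF z) γ]
  exact (measurable_encard_not_isStableAt (fun z => (hF z).1) hFm (fun _ => γ.continuous_extend)
    (fun _ => measurable_const)).div_const _

/-- If the expected knot densities of a random function are bounded by `lam`, then the expected
number of its knots along a path is at most `lam` times the length of the path. -/
theorem lintegral_encard_not_isStableAt_le (μ : Measure Z) {F : Z → EuclideanSpace ℝ (Fin d) → ℝ}
    (hF : ∀ z, IsAffineSelection (F z)) (hFm : ∀ x, Measurable fun z => F z x) {lam : ℝ≥0∞}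
    (γ : CPWLPath d) (hlam : ∫⁻ z, knotDensity (F z) γ ∂μ ≤ lam) :
    ∫⁻ z, ({t | ¬ IsStableAt (F z) γ.extend t}.encard : ℝ≥0∞) ∂μ ≤ lam * γ.length := by
  simp_rw [← fun z => knotsAlong_eq (hF z) γ, fun z => encard_knotsAlong_eq_mul (hF z) γ]
  rw [lintegral_mul_const _ (measurable_knotDensity hF hFm γ)]
  gcongr

end Expectation

/-! ### The expected knot density of a random network -/

theorem corollary3
    {Ω : Type*} [MeasurableSpace Ω] (P : Measure Ω) [IsProbabilityMeasure P]
    {Θ : Type*} [MeasurableSpace Θ]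
    (L W : ℕ) (d : Fin (L + 1) → ℕ)
    -- all hidden widths are equal to `W`, and the output dimension is smaller
    (hwidth : ∀ m : Fin (L + 1), m ≠ 0 → m ≠ Fin.last L → d m = W)
    (hout : d (Fin.last L) < W)
    -- the i.i.d. random parameters of the layers
    (θ : Fin L → Ω → Θ)
    (hθ_meas : ∀ l, Measurable (θ l))
    (hθ_indep : iIndepFun θ P)
    (hθ_ident : ∀ l m, IdentDistrib (θ l) (θ m) P P)
    -- the parameterized CPWL layers; for every input, the output depends measurably on the parameter
    (f : ∀ l : Fin L, Θ →
      EuclideanSpace ℝ (Fin (d l.castSucc)) → EuclideanSpace ℝ (Fin (d l.succ)))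
    (hf_meas : ∀ l x, Measurable fun ϑ => f l ϑ x)
    (hf_cpwl : ∀ l ϑ, IsCPWL (f l ϑ))
    (lam0 D0 : ℝ)
    -- (i) bounded expected knot density of the components of the layers
    (hknot : ∀ (l : Fin L) (k : Fin (d l.succ)) (γ : CPWLPath (d l.castSucc)),
      ∫⁻ ω, knotDensity (fun x => f l (θ l ω) x k) γ ∂P ≤ ENNReal.ofReal lam0)
    -- (ii) bounded expected norm of the directional derivatives of the partial compositions
    -- (where a directional derivative does not exist, it contributes `0`, so that less is assumed)
    (hderiv : ∀ m : Fin (L + 1), m ≠ 0 → ∀ x u : EuclideanSpace ℝ (Fin (d 0)), ‖u‖ = 1 →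
      ∫⁻ ω, ‖lineDeriv ℝ (partialComposition (fun l => f l (θ l ω)) m) x u‖ₑ ∂P
        ≤ ENNReal.ofReal D0) :
    ∀ γ : CPWLPath (d 0),
      AEMeasurable
        (fun ω => knotDensity (partialComposition (fun l => f l (θ l ω)) (Fin.last L)) γ) P ∧
      ∫⁻ ω, knotDensity (partialComposition (fun l => f l (θ l ω)) (Fin.last L)) γ ∂P
        ≤ ENNReal.ofReal (max D0 1 * (lam0 * W * L)) := by
  intro γ
  have hsel : ∀ l ϑ, IsAffineSelection (f l ϑ) := fun l ϑ => (hf_cpwl l ϑ).isAffineSelection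
  set F : (Fin L → Θ) → ∀ m, EuclideanSpace ℝ (Fin (d 0)) → EuclideanSpace ℝ (Fin (d m)) :=
    fun z m => partialComposition (fun l => f l (z l)) m with hF
  have hFsel : ∀ z m, IsAffineSelection (F z m) := fun z m =>
    isAffineSelection_partialComposition (fun l => hsel l (z l)) m
  have hFm : ∀ m x, Measurable fun z => F z m x := fun m x =>
    measurable_partialComposition (g := fun (z : Fin L → Θ) l => f l (z l))
      (fun z l => (hsel l (z l)).1)
      (fun l x => (hf_meas l x).comp (measurable_pi_apply l)) m x
  have hθ : Measurable fun ω l => θ l ω := measurable_pi_lambda _ hθ_meas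
  have hprob : ∀ l, IsProbabilityMeasure (P.map (θ l)) := fun l =>
    Measure.isProbabilityMeasure_map (hθ_meas l).aemeasurable
  set μ := Measure.pi fun l => P.map (θ l) with hμ
  have hlaw : P.map (fun ω l => θ l ω) = μ :=
    (iIndepFun_iff_map_fun_eq_pi_map fun l => (hθ_meas l).aemeasurable).1 hθ_indep
  have hdens := measurable_knotDensity (fun z => hFsel z (Fin.last L)) (hFm _) γ
  refine ⟨(hdens.comp hθ).aemeasurable, ?_⟩
  -- The derivative bound is assumed only for m ≠ 0; the empty composition leaves the length
  -- unchanged, whence the maximum with 1.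
  have hlen : ∀ m, ∫⁻ z, (γ.map (hFsel z m)).length ∂μ ≤ ENNReal.ofReal (max D0 1) * γ.length := by
    intro m
    by_cases hm : m = 0
    · subst hm
      have h1 : ∀ z, (γ.map (hFsel z 0)).length = γ.length := fun _ => rfl
      simp_rw [h1, lintegral_const, measure_univ, mul_one]
      refine le_mul_of_one_le_left (zero_le) ?_
      rw [← ENNReal.ofReal_one]
      exact ENNReal.ofReal_le_ofReal (le_max_right _ _)
    · refine lintegral_length_map_le μ (fun z => hFsel z m) (hFm m) (fun x u hu => ?_) γ
      rw [← hlaw, lintegral_map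
        (measurable_lineDeriv_of_isAffineSelection (fun z => hFsel z m) (hFm m) x u).enorm hθ]
      exact (hderiv m hm x u hu).trans (ENNReal.ofReal_le_ofReal (le_max_left _ _))
  have hcomp_sel : ∀ l (k : Fin (d l.succ)) ϑ, IsAffineSelection fun x => f l ϑ x k :=
    fun l k ϑ => (hsel l ϑ).apply k
  have hcomp_meas : ∀ l (k : Fin (d l.succ)) x, Measurable fun ϑ => f l ϑ x k := fun l k x =>
    (by fun_prop : Measurable fun y : EuclideanSpace ℝ (Fin (d l.succ)) => y k).comp (hf_meas l x)
  set N : ∀ l : Fin L, Fin (d l.succ) → (Fin L → Θ) → ℝ≥0∞ := fun l k z =>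
    ({t | ¬ IsStableAt (fun x => f l (z l) x k) (F z l.castSucc ∘ γ.extend) t}.encard : ℝ≥0∞)
    with hN
  have hNm : ∀ l k, Measurable (N l k) := fun l k =>
    measurable_encard_not_isStableAt (f := fun (z : Fin L → Θ) x => f l (z l) x k)
      (c := fun z => F z l.castSucc ∘ γ.extend) (fun z => (hcomp_sel l k (z l)).1)
      (fun x => (hcomp_meas l k x).comp (measurable_pi_apply l))
      (fun z => (hFsel z _).1.comp γ.continuous_extend) (fun s => hFm _ _)
  have hNint : ∀ l k, ∫⁻ z, N l k z ∂μ ≤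
      ENNReal.ofReal lam0 * (ENNReal.ofReal (max D0 1) * γ.length) := by
    intro l k
    calc ∫⁻ z, N l k z ∂μ
        = ∫⁻ z, ∫⁻ ϑ, N l k (Function.update z l ϑ) ∂(P.map (θ l)) ∂μ :=
          lintegral_pi_eq_lintegral_update _ l (hNm l k)
      _ ≤ ∫⁻ z, ENNReal.ofReal lam0 * (γ.map (hFsel z l.castSucc)).length ∂μ := by
          refine lintegral_mono fun z => ?_
          -- With the other parameters frozen, the input path of layer l is deterministic, so the
          -- knot hypothesis applies to it.
          have hupd : ∀ ϑ, F (Function.update z l ϑ) l.castSucc = F z l.castSucc := by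
            intro ϑ
            refine partialComposition_congr _ fun i hi => ?_
            rw [Function.update_of_ne (ne_of_lt (Fin.castSucc_lt_castSucc_iff.1 hi))]
          simp only [hN, hupd, Function.update_self]
          refine lintegral_encard_not_isStableAt_le _ (hcomp_sel l k) (hcomp_meas l k)
            (γ.map (hFsel z l.castSucc)) ?_
          rw [lintegral_map (measurable_knotDensity (hcomp_sel l k) (hcomp_meas l k) _) (hθ_meas l)]
          exact hknot l k _
      _ = ENNReal.ofReal lam0 * ∫⁻ z, (γ.map (hFsel z l.castSucc)).length ∂μ :=
          lintegral_const_mul' _ _ ENNReal.ofReal_ne_top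
      _ ≤ _ := by gcongr; exact hlen _
  have hwidth_le : ∀ l : Fin L, d l.succ ≤ W := by
    intro l
    by_cases hl : l.succ = Fin.last L
    · rw [hl]
      exact hout.le
    · exact (hwidth _ (Fin.succ_ne_zero l) hl).le
  have hknots : ∫⁻ z, ((knotsAlong (F z (Fin.last L)) γ).encard : ℝ≥0∞) ∂μ ≤
      ENNReal.ofReal (max D0 1 * (lam0 * W * L)) * γ.length := by
    calc ∫⁻ z, ((knotsAlong (F z (Fin.last L)) γ).encard : ℝ≥0∞) ∂μ
        ≤ ∫⁻ z, ∑ l, ∑ k, N l k z ∂μ := by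
          refine lintegral_mono fun z => ?_
          simp only
          rw [knotsAlong_eq (hFsel z _) γ]
          exact encard_not_isStableAt_partialComposition_le (fun l => hsel l (z l)) _ _
      _ = ∑ l, ∑ k, ∫⁻ z, N l k z ∂μ := by
          rw [lintegral_finsetSum _ fun l _ => Finset.measurable_sum _ fun k _ => hNm l k]
          exact Finset.sum_congr rfl fun l _ => lintegral_finsetSum _ fun k _ => hNm l k
      _ ≤ ∑ l : Fin L, W * (ENNReal.ofReal lam0 * (ENNReal.ofReal (max D0 1) * γ.length)) := by
          refine Finset.sum_le_sum fun l _ => (Finset.sum_le_sum fun k _ => hNint l k).trans ?_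
          rw [Finset.sum_const, Finset.card_univ, Fintype.card_fin, nsmul_eq_mul]
          gcongr
          exact hwidth_le l
      _ = ENNReal.ofReal (max D0 1 * (lam0 * W * L)) * γ.length := by
          -- The factors are split off so that only the maximum, W and L need to be nonnegative, not
          -- `lam0`.
          rw [Finset.sum_const, Finset.card_univ, Fintype.card_fin, nsmul_eq_mul,
            ENNReal.ofReal_mul (le_max_of_le_right zero_le_one),
            ENNReal.ofReal_mul' (Nat.cast_nonneg L), ENNReal.ofReal_mul' (Nat.cast_nonneg W),
            ENNReal.ofReal_natCast, ENNReal.ofReal_natCast]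
          ring
  calc ∫⁻ ω, knotDensity (partialComposition (fun l => f l (θ l ω)) (Fin.last L)) γ ∂P
      = ∫⁻ z, knotDensity (F z (Fin.last L)) γ ∂μ := by
        rw [← hlaw, lintegral_map hdens hθ]
    _ ≤ ENNReal.ofReal (max D0 1 * (lam0 * W * L)) := by
        by_cases h0 : γ.length = 0
        · have hz : ∀ z, knotDensity (F z (Fin.last L)) γ = 0 := fun z => by
            simp [knotDensity, knotsAlong_eq_empty_of_length_eq_zero (hFsel z _) h0]
          simp [hz]
        · simp_rw [fun z => encard_knotsAlong_eq_mul (hFsel z (Fin.last L)) γ] at hknots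
          rw [lintegral_mul_const _ hdens] at hknots
          exact (ENNReal.mul_le_mul_iff_left h0 γ.length_lt_top.ne).1 hknots
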